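/- Let $e(x)=e^{2\pi i x}$. A Rademacher random multiplicative function is a random function $f:\mathbb{N}\to\mathbb{C}$ such that $(f(p))_{p\text{ prime}}$ are independent, each taking the values $\pm1$ with probability $1/2$, $f(p^\alpha)=0$ for all primes $p$ and $\alpha\ge 2$, and $f(n)=\prod_{p\mid n} f(p^{v_p(n)})$, where $v_p(n)$ is the exponent of $p$ in $n$. A Steinhaus random multiplicative function is a random function $f:\mathbb{N}\to\mathbb{C}$ such that $(f(p))_{p\text{ prime}}$ are independent, each uniformly distributed on $\{z\in\mathbb{C}:|z|=1\}$, and $f(n)=\prod_{p\mid n} f(p)^{v_p(n)}$. Put $$P_N(\theta)=\frac{1}{\sqrt N}\sum_{1\le n\le N} f(n)\,e(n\theta).$$ **Theorem.** If $f$ is a Rademacher random multiplicative function, then $$\lim_{N\to\infty}\mathbb{P}\Bigl(\max_{\theta\in[0,1]}|P_N(\theta)|\ \ge\ \frac{4\sqrt6}{29\pi}\sqrt{\log N}\Bigr)=1 .$$ If $f$ is a Steinhaus random multiplicative function, then $$\lim_{N\to\infty}\mathbb{P}\Bigl(\max_{\theta\in[0,1]}|P_N(\theta)|\ \ge\ \frac{4}{29}\sqrt{\log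 N}\Bigr)=1 .$$ -/

import Mathlib

open MeasureTheory ProbabilityTheory Filter Topology

/-- The additive character `e(x) = exp(2 π i x)`. -/
noncomputable def expChar (x : ℝ) : ℂ := Complex.exp (2 * Real.pi * Complex.I * x)

/-- The Rademacher law on `ℂ`: the values `1` and `-1`, each with probability `1/2`. -/
noncomputable def rademacherLaw : Measure ℂ :=
  (2⁻¹ : ENNReal) • Measure.dirac 1 + (2⁻¹ : ENNReal) • Measure.dirac (-1)

/-- The Steinhaus law on `ℂ`: the uniform distribution on the unit circle, that is, the law of
`e(t)` for `t` uniform on `[0,1]`. -/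
noncomputable def steinhausLaw : Measure ℂ :=
  (volume.restrict (Set.Icc (0 : ℝ) 1)).map expChar

/-- `f` is a Rademacher random multiplicative function on the probability space `(Ω, P)`.
The value `f 0` is irrelevant and left free. -/
structure IsRademacherRMF {Ω : Type*} [MeasurableSpace Ω] (P : Measure Ω) (f : ℕ → Ω → ℂ) :
    Prop where
  /-- each `f(p)`, `p` prime, is a Rademacher random variable -/
  law_prime : ∀ p : Nat.Primes, HasLaw (f p) rademacherLaw P
  /-- the `f(p)`, `p` prime, are independent -/
  indep : iIndepFun (fun (p : Nat.Primes) => f p) P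
  /-- `f` vanishes at higher prime powers -/
  prime_pow : ∀ p : ℕ, p.Prime → ∀ a : ℕ, 2 ≤ a → ∀ ω, f (p ^ a) ω = 0
  /-- `f` is extended multiplicatively; the empty product gives `f(1) = 1` -/
  eq_prod : ∀ n : ℕ, 1 ≤ n → ∀ ω, f n ω = ∏ p ∈ n.primeFactors, f (p ^ n.factorization p) ω

/-- `f` is a Steinhaus random multiplicative function on the probability space `(Ω, P)`.
The value `f 0` is irrelevant and left free. -/
structure IsSteinhausRMF {Ω : Type*} [MeasurableSpace Ω] (P : Measure Ω) (f : ℕ → Ω → ℂ) :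
    Prop where
  /-- each `f(p)`, `p` prime, is a Steinhaus random variable -/
  law_prime : ∀ p : Nat.Primes, HasLaw (f p) steinhausLaw P
  /-- the `f(p)`, `p` prime, are independent -/
  indep : iIndepFun (fun (p : Nat.Primes) => f p) P
  /-- `f` is extended completely multiplicatively; the empty product gives `f(1) = 1` -/
  eq_prod : ∀ n : ℕ, 1 ≤ n → ∀ ω, f n ω = ∏ p ∈ n.primeFactors, f p ω ^ n.factorization p

/-- The trigonometric polynomial `P_N(θ) = N^{-1/2} ∑_{1 ≤ n ≤ N} a(n) e(nθ)`. -/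
noncomputable def trigPoly (a : ℕ → ℂ) (N : ℕ) (θ : ℝ) : ℂ :=
  ((1 / Real.sqrt N : ℝ) : ℂ) * ∑ n ∈ Finset.Icc 1 N, a n * expChar (n * θ)

/-- `max_{θ ∈ [0,1]} |P_N(θ)|`, as a supremum; it is attained by `isGreatest_maxTrigPoly`. -/
noncomputable def maxTrigPoly (a : ℕ → ℂ) (N : ℕ) : ℝ :=
  sSup ((fun θ : ℝ => ‖trigPoly a N θ‖) '' Set.Icc 0 1)

theorem isGreatest_maxTrigPoly (a : ℕ → ℂ) (N : ℕ) :
    IsGreatest ((fun θ : ℝ => ‖trigPoly a N θ‖) '' Set.Icc 0 1) (maxTrigPoly a N) := by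
  have hc : Continuous (fun θ : ℝ => ‖trigPoly a N θ‖) := by
    unfold trigPoly expChar
    fun_prop
  exact (isCompact_Icc.image hc).isGreatest_sSup ((Set.nonempty_Icc.2 zero_le_one).image _)

/-! Call a prime large if it lies in `(k, N]`, where `k` is the integer part of `N^(7/10)`. Since `2
* N < (k + 1)^2`, an `n ≤ N` has at most one large prime factor. Hence the exponential sum is `A(θ)
+ ∑ f(p) F_p(θ)`, with `p` over the large primes and `F_p(θ) = ∑_{m ≤ N/p} f(m) e(mpθ)`. Both `A`
and the `F_p` depend only on the values of `f` at small primes. With those values frozen, what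
remains is a sum of independent terms for each `θ`, which behaves like a Gaussian process in `θ`.

The points `θ = j/M` with `M = 4N + 1` are sampled. Trigonometric polynomials with frequencies in
`pℤ` and in `qℤ`, of degree below `pq`, are uncorrelated over these points (`cycAvg_mul`,
`sum_sq_sum_eq`). So at most `j` the conditional variance is close to its mean `W * N`, and for most
pairs `j, k` the covariance is negligible (`sum_sq_sum_quadForm_sub_le`,
`sum_sum_sq_sum_bilinForm_le`). The mean involves only `|f(m)|^2`, which is deterministic, so `W` is
not affected by the conditioning.

The second moment method is applied to `Z = ∑ exp(R_j)` over good `j`, where `R_j` is `β / √N` times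
the real part of the random sum (`measure_forall_lt_le`). The exponential moments are Gaussian up to
fourth order, so `Z` concentrates as long as the proportion of correlated pairs, about `N^(-7/10)`
up to powers of `log N`, beats `exp(β^2 W)`. Taking `β^2 W = (2/3) log N` makes some `R_j` at least
`(log N)/3 - 2`, and dividing by `β` gives a maximum of about `√(W/6) √(log N)`.

It remains to bound `W` below. Legendre's formula for `N!` with Chebyshev-type bounds gives `∑ ⌊N/p⌋
≥ (3/10 - o(1)) N` over large primes. Thus `W` is at least about `3/20` for Steinhaus, and about
`3/40` for Rademacher because at least half of the integers up to any bound are squarefree. Both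
values leave room above the stated constants. -/

/-! ### Chebyshev and Mertens type estimates for large primes -/

/-- The primes in the interval `(k, N]`. -/
def primesIoc (k N : ℕ) : Finset ℕ := (Finset.Ioc k N).filter Nat.Prime

theorem mem_primesIoc {k N p : ℕ} : p ∈ primesIoc k N ↔ (k < p ∧ p ≤ N) ∧ p.Prime := by
  simp [primesIoc]

theorem log_factorial_eq_sum (N : ℕ) :
    Real.log (N.factorial) =
      ∑ p ∈ primesIoc 0 N, ((N.factorial).factorization p : ℝ) * Real.log p := by
  rw [Real.log_nat_eq_sum_factorization, Finsupp.sum]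
  refine Finset.sum_subset ?_ ?_
  · intro p hp
    have hp' := Nat.support_factorization (N.factorial) ▸ hp
    have h1 := Nat.prime_of_mem_primeFactors hp'
    exact mem_primesIoc.2 ⟨⟨h1.pos, (h1.dvd_factorial).1 (Nat.dvd_of_mem_primeFactors hp')⟩, h1⟩
  · intro p _ hp
    simp [Finsupp.notMem_support_iff.1 hp]

theorem div_le_factorization_factorial {p n : ℕ} (hp : p.Prime) :
    n / p ≤ (n.factorial).factorization p := by
  rw [Nat.factorization_factorial (b := Nat.log p n + 2) hp (by omega)]
  have h := Finset.single_le_sum (f := fun i => n / p ^ i) (s := Finset.Ico 1 (Nat.log p n + 2))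
    (fun i _ => Nat.zero_le _) (a := 1) (by simp)
  simpa using h

theorem factorization_factorial_of_lt_sq {p n : ℕ} (hp : p.Prime) (h : n < p ^ 2) :
    (n.factorial).factorization p = n / p := by
  rw [Nat.factorization_factorial (b := 2) hp]
  · simp
  · rcases Nat.eq_zero_or_pos n with rfl | hn
    · simp
    · exact Nat.log_lt_of_lt_pow hn.ne' h

/-- Upper half of Mertens' first theorem: replacing `k / p` by its integer part costs `∑ log p ≤ k
log 4`, and the integer parts are bounded by the exponents in `k!`, where `log k! ≤ k log k`. -/
theorem sum_primesIoc_log_div_le {k : ℕ} (hk : 1 ≤ k) :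
    ∑ p ∈ primesIoc 0 k, Real.log p / p ≤ Real.log k + Real.log 4 := by
  have hk0 : (0 : ℝ) < k := by exact_mod_cast hk
  have hθ : ∑ p ∈ primesIoc 0 k, Real.log p ≤ Real.log 4 * k := by
    have := Chebyshev.theta_le_log4_mul_x (x := k) (by positivity)
    rwa [Chebyshev.theta, Nat.floor_natCast] at this
  have hfac : Real.log (k.factorial) ≤ k * Real.log k := by
    rw [← Real.log_pow]
    exact Real.log_le_log (by positivity) (by exact_mod_cast k.factorial_le_pow)
  have key : k * ∑ p ∈ primesIoc 0 k, Real.log p / p ≤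
      ∑ p ∈ primesIoc 0 k, (((k.factorial).factorization p : ℝ) * Real.log p + Real.log p) := by
    rw [Finset.mul_sum]
    refine Finset.sum_le_sum fun p hp => ?_
    have hp' := (mem_primesIoc.1 hp).2
    have h1 : (k : ℝ) / p ≤ (k / p : ℕ) + 1 := by
      rw [div_le_iff₀ (by exact_mod_cast hp'.pos)]
      have := Nat.lt_mul_div_succ k hp'.pos
      have h2 : (k : ℝ) ≤ p * ((k / p : ℕ) + 1) := by exact_mod_cast this.le
      linarith
    have h2 : ((k / p : ℕ) : ℝ) ≤ (k.factorial).factorization p := by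
      exact_mod_cast div_le_factorization_factorial hp'
    have h3 : 0 ≤ Real.log p := Real.log_natCast_nonneg p
    calc k * (Real.log p / p) = k / p * Real.log p := by ring
      _ ≤ ((k.factorial).factorization p + 1) * Real.log p := by gcongr; linarith
      _ = _ := by ring
  rw [Finset.sum_add_distrib, ← log_factorial_eq_sum] at key
  have : k * ∑ p ∈ primesIoc 0 k, Real.log p / p ≤ k * (Real.log k + Real.log 4) := by linarith
  exact le_of_mul_le_mul_left this hk0

/-- Legendre's formula bounds the exponent of `p` in `N!` by `N / (p - 1)`, so Mertens' sum is
needed with `p - 1`. The difference is a convergent series, since `log p ≤ 2 √p`. -/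
theorem exists_sum_primesIoc_log_div_pred_le :
    ∃ C : ℝ, ∀ k : ℕ, 1 ≤ k →
      ∑ p ∈ primesIoc 0 k, Real.log p / (p - 1) ≤ Real.log k + C := by
  have hs : Summable (fun n : ℕ => 4 * (1 / (n : ℝ) ^ (3 / 2 : ℝ))) :=
    (Real.summable_one_div_nat_rpow.2 (by norm_num)).mul_left 4
  refine ⟨Real.log 4 + ∑' n : ℕ, 4 * (1 / (n : ℝ) ^ (3 / 2 : ℝ)), fun k hk => ?_⟩
  have h1 : ∀ p ∈ primesIoc 0 k, Real.log p / ((p : ℝ) - 1) ≤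
      Real.log p / p + 4 * (1 / (p : ℝ) ^ (3 / 2 : ℝ)) := by
    intro p hp
    have hp2 : (2 : ℝ) ≤ p := by exact_mod_cast (mem_primesIoc.1 hp).2.two_le
    have hp0 : (0 : ℝ) < p := by linarith
    have hl := Real.log_le_rpow_div hp0.le (ε := 1 / 2) (by norm_num)
    have e : (p : ℝ) ^ (3 / 2 : ℝ) * (p : ℝ) ^ (1 / 2 : ℝ) = p ^ 2 := by
      rw [← Real.rpow_add hp0]; norm_num
    have h32 : (0 : ℝ) < (p : ℝ) ^ (3 / 2 : ℝ) := by positivity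
    have e2 : Real.log p / ((p : ℝ) - 1) - Real.log p / p = Real.log p / (p * (p - 1)) := by
      have : (p : ℝ) - 1 ≠ 0 := by linarith
      field_simp; ring
    have : Real.log p / (p * (p - 1)) ≤ 4 * (1 / (p : ℝ) ^ (3 / 2 : ℝ)) := by
      rw [mul_one_div, div_le_div_iff₀ (by nlinarith) h32]
      calc Real.log p * (p : ℝ) ^ (3 / 2 : ℝ)
          ≤ (p : ℝ) ^ (1 / 2 : ℝ) / (1 / 2) * (p : ℝ) ^ (3 / 2 : ℝ) := by gcongr
        _ = 2 * p ^ 2 := by rw [← e]; ring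
        _ ≤ 4 * (p * (p - 1)) := by nlinarith
    linarith
  have h2 : ∑ p ∈ primesIoc 0 k, 4 * (1 / (p : ℝ) ^ (3 / 2 : ℝ)) ≤
      ∑' n : ℕ, 4 * (1 / (n : ℝ) ^ (3 / 2 : ℝ)) :=
    hs.sum_le_tsum _ fun n _ => by positivity
  have h3 := Finset.sum_le_sum h1
  rw [Finset.sum_add_distrib] at h3
  linarith [sum_primesIoc_log_div_le hk]

/-- Compare Stirling's lower bound for `log N!` with its prime factorization. Primes up to `k`
account for at most `N (log k + C)`. A prime beyond `k` has exponent exactly `⌊N/p⌋` because its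
square exceeds `N`, and its logarithm is at most `log N`. -/
theorem exists_le_sum_primesIoc_div :
    ∃ C : ℝ, ∀ k N : ℕ, 1 ≤ k → k ≤ N → N < (k + 1) ^ 2 →
      N * (Real.log N - Real.log k - C) ≤
        (∑ p ∈ primesIoc k N, ((N / p : ℕ) : ℝ)) * Real.log N := by
  obtain ⟨C, hC⟩ := exists_sum_primesIoc_log_div_pred_le
  -- The extra `1` pays for the term `-N` in Stirling's formula.
  refine ⟨C + 1, fun k N hk hkN hN => ?_⟩
  have hN0 : N ≠ 0 := by omega
  have hst := Stirling.le_log_factorial_stirling hN0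
  have hlogN : 0 ≤ Real.log N := Real.log_natCast_nonneg N
  have hpi : 0 ≤ Real.log (2 * Real.pi) :=
    Real.log_nonneg (by linarith [Real.pi_gt_three])
  have hsplit : primesIoc 0 N = primesIoc 0 k ∪ primesIoc k N := by
    ext p; simp only [Finset.mem_union, mem_primesIoc]
    constructor
    · rintro ⟨⟨h1, h2⟩, h3⟩
      rcases le_or_gt p k with h | h
      · exact Or.inl ⟨⟨h1, h⟩, h3⟩
      · exact Or.inr ⟨⟨h, h2⟩, h3⟩
    · rintro (⟨⟨h1, h2⟩, h3⟩ | ⟨⟨h1, h2⟩, h3⟩)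
      · exact ⟨⟨h1, h2.trans hkN⟩, h3⟩
      · exact ⟨⟨by omega, h2⟩, h3⟩
  have hdisj : Disjoint (primesIoc 0 k) (primesIoc k N) := by
    rw [Finset.disjoint_left]
    intro p h1 h2
    have := (mem_primesIoc.1 h1).1.2
    have := (mem_primesIoc.1 h2).1.1
    omega
  have h := log_factorial_eq_sum N
  rw [hsplit, Finset.sum_union hdisj] at h
  have hsmall : ∑ p ∈ primesIoc 0 k, ((N.factorial).factorization p : ℝ) * Real.log p ≤
      N * (Real.log k + C) := by
    refine le_trans ?_ (mul_le_mul_of_nonneg_left (hC k hk) (Nat.cast_nonneg N))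
    rw [Finset.mul_sum]
    refine Finset.sum_le_sum fun p hp => ?_
    have hp' := (mem_primesIoc.1 hp).2
    have hp2 : (2 : ℝ) ≤ p := by exact_mod_cast hp'.two_le
    have h1 : ((N.factorial).factorization p : ℝ) ≤ N / ((p : ℝ) - 1) := by
      have h1 := Nat.factorization_factorial_le_div_pred hp' N
      have h2 : ((N / (p - 1) : ℕ) : ℝ) ≤ N / ((p - 1 : ℕ) : ℝ) := Nat.cast_div_le
      rw [Nat.cast_sub hp'.one_le, Nat.cast_one] at h2
      exact le_trans (by exact_mod_cast h1) h2
    calc _ ≤ N / ((p : ℝ) - 1) * Real.log p := by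
          gcongr
      _ = _ := by ring
  have hlarge : ∑ p ∈ primesIoc k N, ((N.factorial).factorization p : ℝ) * Real.log p ≤
      (∑ p ∈ primesIoc k N, ((N / p : ℕ) : ℝ)) * Real.log N := by
    rw [Finset.sum_mul]
    refine Finset.sum_le_sum fun p hp => ?_
    obtain ⟨⟨h1, h2⟩, h3⟩ := mem_primesIoc.1 hp
    rw [factorization_factorial_of_lt_sq h3 (hN.trans_le (Nat.pow_le_pow_left h1 2))]
    have : (0 : ℝ) < p := by exact_mod_cast h3.pos
    gcongr
  nlinarith

/-! ### Density of squarefree numbers -/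

/-- The primes are enlarged to `2` and all odd numbers from `3` on. The odd part telescopes to at
most `1/4`, because `(2i + 3)^2 > 4 (i + 1) (i + 2)`. -/
theorem sum_inv_sq_sub_le (M : ℕ) :
    ∑ d ∈ insert 2 ((Finset.range M).image fun i : ℕ => 2 * i + 3), (1 : ℝ) / (d : ℕ) ^ 2 ≤
      1 / 2 := by
  have h2 : 2 ∉ (Finset.range M).image fun i : ℕ => 2 * i + 3 := by
    intro h
    obtain ⟨i, -, hi⟩ := Finset.mem_image.1 h
    omega
  rw [Finset.sum_insert h2, Finset.sum_image (by intro a _ b _ h; simpa using h)]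
  have : ∀ M : ℕ, ∑ i ∈ Finset.range M, (1 : ℝ) / ((2 * i + 3 : ℕ) : ℝ) ^ 2 ≤
      1 / 4 - 1 / (4 * (M + 1)) := by
    intro M
    induction M with
    | zero => simp
    | succ M ih =>
      rw [Finset.sum_range_succ]
      have : (1 : ℝ) / ((2 * M + 3 : ℕ) : ℝ) ^ 2 ≤
          1 / (4 * (M + 1)) - 1 / (4 * ((M + 1 : ℕ) + 1)) := by
        push_cast
        rw [div_sub_div _ _ (by positivity) (by positivity),
          div_le_div_iff₀ (by positivity) (by positivity)]
        nlinarith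
      linarith
  have h1 := this M
  have h2 : (0 : ℝ) ≤ 1 / (4 * (M + 1)) := by positivity
  have h3 : (1 : ℝ) / (2 : ℕ) ^ 2 = 1 / 4 := by norm_num
  linarith

/-- Union bound: a number that is not squarefree is divisible by some `d^2` with `d` in the set of
`sum_inv_sq_sub_le`. -/
theorem half_le_card_squarefree (M : ℕ) :
    (M : ℝ) / 2 ≤ ((Finset.Icc 1 M).filter Squarefree).card := by
  set D : Finset ℕ := insert 2 ((Finset.range M).image fun i => 2 * i + 3) with hD
  have hcover : (Finset.Icc 1 M).filter (fun n => ¬ Squarefree n) ⊆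
      D.biUnion fun d => (Finset.Ioc 0 M).filter (fun n => d ^ 2 ∣ n) := by
    intro n hn
    obtain ⟨hn1, hn2⟩ := Finset.mem_filter.1 hn
    rw [Finset.mem_Icc] at hn1
    rw [Nat.squarefree_iff_prime_squarefree] at hn2
    push Not at hn2
    obtain ⟨p, hp, hpn⟩ := hn2
    rw [Finset.mem_biUnion]
    refine ⟨p, ?_, ?_⟩
    · rcases hp.eq_two_or_odd' with rfl | ⟨i, hi⟩
      · simp [hD]
      · refine Finset.mem_insert_of_mem (Finset.mem_image.2 ⟨i - 1, ?_, ?_⟩)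
        · have := Nat.le_of_dvd hn1.1 hpn
          have := hp.two_le
          rw [Finset.mem_range]
          have : p ≤ p * p := Nat.le_mul_self p
          omega
        · have := hp.two_le
          omega
    · simp only [Finset.mem_filter, Finset.mem_Ioc]
      exact ⟨⟨by omega, hn1.2⟩, by rwa [pow_two]⟩
  have hcard : (((Finset.Icc 1 M).filter (fun n => ¬ Squarefree n)).card : ℝ) ≤ M / 2 := by
    have h1 := (Finset.card_le_card hcover).trans Finset.card_biUnion_le
    have h2 : (∑ d ∈ D, ((Finset.Ioc 0 M).filter (fun n => d ^ 2 ∣ n)).card : ℝ) ≤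
        ∑ d ∈ D, M * ((1 : ℝ) / d ^ 2) := by
      refine Finset.sum_le_sum fun d _ => ?_
      rw [Nat.Ioc_filter_dvd_card_eq_div]
      refine Nat.cast_div_le.trans ?_
      push_cast
      rw [mul_one_div]
    rw [← Finset.mul_sum] at h2
    have h3 := mul_le_mul_of_nonneg_left (sum_inv_sq_sub_le M) (Nat.cast_nonneg (α := ℝ) M)
    calc _ ≤ (∑ d ∈ D, ((Finset.Ioc 0 M).filter (fun n => d ^ 2 ∣ n)).card : ℝ) := by
          exact_mod_cast h1
      _ ≤ _ := by linarith
  have := Finset.card_filter_add_card_filter_not (s := Finset.Icc 1 M) Squarefree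
  rw [Nat.card_Icc] at this
  have : ((Finset.card ((Finset.Icc 1 M).filter Squarefree) : ℝ)) +
    ((Finset.Icc 1 M).filter (fun n => ¬ Squarefree n)).card = M := by exact_mod_cast this
  linarith

/-! ### Tails of inverse powers over large primes -/

theorem sum_primesIoc_inv_sq_le {k N : ℕ} (hk : k ≠ 0) :
    ∑ p ∈ primesIoc k N, ((p : ℝ) ^ 2)⁻¹ ≤ (k : ℝ)⁻¹ := by
  rcases le_or_gt k N with h | h
  · refine (Finset.sum_le_sum_of_subset_of_nonneg (Finset.filter_subset _ _)
      fun _ _ _ => by positivity).trans ((sum_Ioc_inv_sq_le_sub hk h).trans ?_)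
    linarith [show (0 : ℝ) ≤ (N : ℝ)⁻¹ by positivity]
  · simp [primesIoc, Finset.Ioc_eq_empty_of_le h.le]

theorem sum_primesIoc_inv_pow_four_le {k N : ℕ} (hk : k ≠ 0) :
    ∑ p ∈ primesIoc k N, ((p : ℝ) ^ 4)⁻¹ ≤ ((k : ℝ) ^ 3)⁻¹ := by
  have hk0 : (0 : ℝ) < k := by positivity
  calc ∑ p ∈ primesIoc k N, ((p : ℝ) ^ 4)⁻¹
      ≤ ∑ p ∈ primesIoc k N, ((k : ℝ) ^ 2)⁻¹ * ((p : ℝ) ^ 2)⁻¹ := by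
        refine Finset.sum_le_sum fun p hp => ?_
        have : (k : ℝ) ≤ p := by exact_mod_cast (mem_primesIoc.1 hp).1.1.le
        rw [← mul_inv, show (p : ℝ) ^ 4 = p ^ 2 * p ^ 2 by ring]
        have hp0 : (0 : ℝ) < p := hk0.trans_le this
        exact inv_anti₀ (by positivity) (by gcongr)
    _ ≤ ((k : ℝ) ^ 2)⁻¹ * (k : ℝ)⁻¹ := by
        rw [← Finset.mul_sum]
        gcongr
        exact sum_primesIoc_inv_sq_le hk
    _ = _ := by rw [← mul_inv]; ring

/-! ### Projected variances and exponential moments of one variable -/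

/-- The variance of `Re (z ξ)`, where `ξ` is a random variable on the unit circle with `E ξ = 0`
and `E ξ ^ 2 = κ`. -/
noncomputable def quadForm (κ : ℝ) (z : ℂ) : ℝ := (‖z‖ ^ 2 + κ * (z ^ 2).re) / 2

/-- The covariance of `Re (z ξ)` and `Re (w ξ)` belonging to `quadForm`. -/
noncomputable def bilinForm (κ : ℝ) (z w : ℂ) : ℝ :=
  ((z * (starRingEnd ℂ) w).re + κ * (z * w).re) / 2

theorem quadForm_eq (κ : ℝ) (z : ℂ) :
    quadForm κ z = ((1 + κ) * z.re ^ 2 + (1 - κ) * z.im ^ 2) / 2 := by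
  rw [quadForm, Complex.sq_norm, Complex.normSq_apply, pow_two z, Complex.mul_re]
  ring

theorem bilinForm_eq (κ : ℝ) (z w : ℂ) :
    bilinForm κ z w = ((1 + κ) * (z.re * w.re) + (1 - κ) * (z.im * w.im)) / 2 := by
  simp only [bilinForm, Complex.mul_re, Complex.conj_re, Complex.conj_im]
  ring

theorem quadForm_add (κ : ℝ) (z w : ℂ) :
    quadForm κ (z + w) = quadForm κ z + quadForm κ w + 2 * bilinForm κ z w := by
  simp only [quadForm_eq, bilinForm_eq, Complex.add_re, Complex.add_im]
  ring

theorem quadForm_real_mul (κ c : ℝ) (z : ℂ) : quadForm κ (c * z) = c ^ 2 * quadForm κ z := by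
  simp only [quadForm_eq, Complex.re_ofReal_mul, Complex.im_ofReal_mul]
  ring

theorem quadForm_nonneg {κ : ℝ} (h0 : 0 ≤ κ) (h1 : κ ≤ 1) (z : ℂ) : 0 ≤ quadForm κ z := by
  rw [quadForm_eq]
  have : 0 ≤ 1 - κ := by linarith
  positivity

theorem quadForm_le {κ : ℝ} (h0 : 0 ≤ κ) (h1 : κ ≤ 1) (z : ℂ) : quadForm κ z ≤ ‖z‖ ^ 2 := by
  rw [quadForm_eq, Complex.sq_norm, Complex.normSq_apply]
  nlinarith [mul_nonneg (sub_nonneg.2 h1) (sq_nonneg z.re), mul_nonneg h0 (sq_nonneg z.im),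
    sq_nonneg z.im]

theorem abs_bilinForm_le {κ : ℝ} (h0 : 0 ≤ κ) (h1 : κ ≤ 1) (z w : ℂ) :
    |bilinForm κ z w| ≤ ‖z‖ * ‖w‖ := by
  have a : |(z * (starRingEnd ℂ) w).re| ≤ ‖z‖ * ‖w‖ := by
    simpa using Complex.abs_re_le_norm (z * (starRingEnd ℂ) w)
  have b : |(z * w).re| ≤ ‖z‖ * ‖w‖ := by simpa using Complex.abs_re_le_norm (z * w)
  have c : |κ * (z * w).re| ≤ ‖z‖ * ‖w‖ := by
    rw [abs_mul, abs_of_nonneg h0]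
    calc κ * |(z * w).re| ≤ 1 * |(z * w).re| := by gcongr
      _ ≤ _ := by rwa [one_mul]
  rw [bilinForm, abs_div, abs_two]
  linarith [abs_add_le (z * (starRingEnd ℂ) w).re (κ * (z * w).re)]

theorem two_mul_bilinForm_le {κ : ℝ} (h0 : 0 ≤ κ) (h1 : κ ≤ 1) (z w : ℂ) :
    2 * bilinForm κ z w ≤ quadForm κ z + quadForm κ w := by
  have := quadForm_nonneg h0 h1 (z - w)
  have e : quadForm κ (z - w) = quadForm κ z + quadForm κ w - 2 * bilinForm κ z w := by
    simp only [quadForm_eq, bilinForm_eq, Complex.sub_re, Complex.sub_im]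
    ring
  linarith

/-- `ξ` lies on the unit circle and its real projections have first and third moments zero and
second moments given by `quadForm κ`. -/
structure HasProjMoments {Ω : Type*} [MeasurableSpace Ω] (κ : ℝ) (ξ : Ω → ℂ) (P : Measure Ω) :
    Prop where
  aemeasurable : AEMeasurable ξ P
  norm_eq_one : ∀ᵐ ω ∂P, ‖ξ ω‖ = 1
  integral_re : ∀ z : ℂ, ∫ ω, (z * ξ ω).re ∂P = 0
  integral_re_sq : ∀ z : ℂ, ∫ ω, (z * ξ ω).re ^ 2 ∂P = quadForm κ z
  integral_re_cube : ∀ z : ℂ, ∫ ω, (z * ξ ω).re ^ 3 ∂P = 0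

/-- The odd terms of the cubic Taylor polynomial integrate to zero, so the first error is of fourth
order. -/
theorem HasProjMoments.abs_integral_exp_sub_le {Ω : Type*} [MeasurableSpace Ω] {κ : ℝ}
    {ξ : Ω → ℂ} {P : Measure Ω} [IsProbabilityMeasure P] (h : HasProjMoments κ ξ P) {z : ℂ}
    (hz : ‖z‖ ≤ 1) :
    |∫ ω, Real.exp (z * ξ ω).re ∂P - (1 + quadForm κ z / 2)| ≤ 5 / 96 * ‖z‖ ^ 4 := by
  have hX : ∀ᵐ ω ∂P, |(z * ξ ω).re| ≤ ‖z‖ := by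
    filter_upwards [h.norm_eq_one] with ω hω
    simpa [hω] using Complex.abs_re_le_norm (z * ξ ω)
  have hm : AEMeasurable (fun ω => (z * ξ ω).re) P :=
    Complex.measurable_re.comp_aemeasurable (h.aemeasurable.const_mul z)
  have hb : ∀ n : ℕ, Integrable (fun ω => (z * ξ ω).re ^ n) P := by
    intro n
    refine Integrable.of_bound (hm.pow_const n).aestronglyMeasurable (‖z‖ ^ n) ?_
    filter_upwards [hX] with ω hω
    rw [Real.norm_eq_abs, abs_pow]
    gcongr
  have he : Integrable (fun ω => Real.exp (z * ξ ω).re) P := by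
    refine Integrable.of_bound hm.exp.aestronglyMeasurable (Real.exp ‖z‖) ?_
    filter_upwards [hX] with ω hω
    rw [Real.norm_eq_abs, Real.abs_exp]
    exact Real.exp_le_exp.2 ((le_abs_self _).trans hω)
  have hb1 : Integrable (fun ω => (z * ξ ω).re) P := by simpa using hb 1
  have key : ∫ ω, (Real.exp (z * ξ ω).re - (1 + (z * ξ ω).re + (z * ξ ω).re ^ 2 / 2
      + (z * ξ ω).re ^ 3 / 6)) ∂P = ∫ ω, Real.exp (z * ξ ω).re ∂P - (1 + quadForm κ z / 2) := by
    have i1 : Integrable (fun ω => 1 + (z * ξ ω).re) P := (integrable_const _).add hb1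
    have i2 : Integrable (fun ω => 1 + (z * ξ ω).re + (z * ξ ω).re ^ 2 / 2) P :=
      i1.add ((hb 2).div_const 2)
    have i3 : Integrable (fun ω => 1 + (z * ξ ω).re + (z * ξ ω).re ^ 2 / 2
      + (z * ξ ω).re ^ 3 / 6) P := i2.add ((hb 3).div_const 6)
    rw [integral_sub he i3, integral_add i2 ((hb 3).div_const 6),
      integral_add i1 ((hb 2).div_const 2), integral_add (integrable_const _) hb1, integral_div,
      integral_div, h.integral_re, h.integral_re_sq, h.integral_re_cube]
    simp
  rw [← key, ← Real.norm_eq_abs]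
  refine (norm_integral_le_of_norm_le_const (C := 5 / 96 * ‖z‖ ^ 4) ?_).trans (by simp)
  filter_upwards [hX] with ω hω
  rw [Real.norm_eq_abs]
  generalize (z * ξ ω).re = x at hω
  -- Taylor remainder of order four; its constant is `5 / (4! * 4) = 5/96`.
  have := Real.exp_bound (hω.trans hz) (n := 4) (by norm_num)
  simp only [Finset.sum_range_succ, Finset.sum_range_zero, Nat.factorial] at this
  norm_num at this
  calc _ ≤ |x| ^ 4 * (5 / 96) := this
    _ ≤ ‖z‖ ^ 4 * (5 / 96) := by gcongr
    _ = _ := by ring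

theorem HasProjMoments.integral_exp_le {Ω : Type*} [MeasurableSpace Ω] {κ : ℝ}
    {ξ : Ω → ℂ} {P : Measure Ω} [IsProbabilityMeasure P] (h : HasProjMoments κ ξ P) {z : ℂ}
    (hz : ‖z‖ ≤ 1) :
    ∫ ω, Real.exp (z * ξ ω).re ∂P ≤ Real.exp (quadForm κ z / 2 + ‖z‖ ^ 4) := by
  have h1 := (abs_le.1 (h.abs_integral_exp_sub_le hz)).2
  have h2 := Real.add_one_le_exp (quadForm κ z / 2 + ‖z‖ ^ 4)
  have h3 : 0 ≤ ‖z‖ ^ 4 := by positivity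
  linarith

theorem HasProjMoments.le_integral_exp {Ω : Type*} [MeasurableSpace Ω] {κ : ℝ}
    (hκ0 : 0 ≤ κ) (hκ1 : κ ≤ 1)
    {ξ : Ω → ℂ} {P : Measure Ω} [IsProbabilityMeasure P] (h : HasProjMoments κ ξ P) {z : ℂ}
    (hz : ‖z‖ ≤ 1 / 2) :
    Real.exp (quadForm κ z / 2 - ‖z‖ ^ 4) ≤ ∫ ω, Real.exp (z * ξ ω).re ∂P := by
  have h1 := (abs_le.1 (h.abs_integral_exp_sub_le (hz.trans (by norm_num)))).1
  have hq0 := quadForm_nonneg hκ0 hκ1 z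
  have hq1 := quadForm_le hκ0 hκ1 z
  have hn := norm_nonneg z
  set r := ‖z‖
  set u := quadForm κ z / 2
  have hr2 : r ^ 2 ≤ 1 / 4 := by nlinarith
  have hr4 : r ^ 4 = r ^ 2 * r ^ 2 := by ring
  have ht : |u - r ^ 4| ≤ r ^ 2 / 2 := by
    have hu : u ≤ r ^ 2 / 2 := div_le_div_of_nonneg_right hq1 zero_le_two
    have hu0 : 0 ≤ u := div_nonneg hq0 zero_le_two
    rw [abs_le]
    constructor <;> nlinarith [sq_nonneg r]
  -- Use `exp t ≤ 1 + t + t^2` at `t = u - r^4`. Since `t^2 ≤ r^4 / 4`, the loss `-r^4` covers both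
  -- `t^2` and the Taylor error.
  have h2 := Real.abs_exp_sub_one_sub_id_le (ht.trans (by linarith) : |u - r ^ 4| ≤ 1)
  have h3 := (abs_le.1 h2).2
  have h4 : (u - r ^ 4) ^ 2 ≤ (r ^ 2 / 2) ^ 2 := by
    rw [← sq_abs]
    gcongr
  nlinarith [sq_nonneg (r ^ 2)]

/-! ### The Rademacher and Steinhaus laws -/

theorem measurable_norm_eq_one : Measurable fun x : ℂ => ‖x‖ = 1 :=
  measurableSet_setOfPred.1 (measurableSet_eq_fun measurable_norm measurable_const)

theorem hasProjMoments_rademacher {Ω : Type*} [MeasurableSpace Ω] {ξ : Ω → ℂ} {P : Measure Ω}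
    (h : HasLaw ξ rademacherLaw P) : HasProjMoments 1 ξ P := by
  have hint : ∀ g : ℂ → ℝ, Measurable g → ∫ ω, g (ξ ω) ∂P = (g 1 + g (-1)) / 2 := by
    intro g hg
    have := h.integral_comp (f := g) hg.aestronglyMeasurable
    rw [Function.comp_def] at this
    rw [this, rademacherLaw, integral_add_measure, integral_smul_measure, integral_smul_measure,
      integral_dirac, integral_dirac]
    · simp; ring
    · exact (integrable_dirac (by simp)).smul_measure (by simp)
    · exact (integrable_dirac (by simp)).smul_measure (by simp)
  have hm : ∀ z : ℂ, Measurable fun x : ℂ => (z * x).re := fun z =>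
    Complex.measurable_re.comp (measurable_const_mul z)
  refine ⟨h.aemeasurable, ?_, fun z => ?_, fun z => ?_, fun z => ?_⟩
  · rw [h.ae_iff measurable_norm_eq_one, rademacherLaw]
    rw [ae_add_measure_iff]
    have hs := measurableSet_setOfPred.2 measurable_norm_eq_one
    constructor <;> refine Measure.ae_smul_measure ((ae_dirac_iff hs).2 ?_) _ <;> simp
  · rw [hint _ (hm z)]; simp
  · rw [hint _ ((hm z).pow_const 2), quadForm_eq]; simp; ring
  · rw [hint _ ((hm z).pow_const 3)]; simp; ring

theorem continuous_expChar : Continuous expChar := by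
  unfold expChar; fun_prop

theorem norm_expChar (x : ℝ) : ‖expChar x‖ = 1 := by
  rw [expChar, show 2 * (Real.pi : ℂ) * Complex.I * x = ((2 * Real.pi * x : ℝ) : ℂ) * Complex.I by
    push_cast; ring, Complex.norm_exp_ofReal_mul_I]

theorem expChar_add (x y : ℝ) : expChar (x + y) = expChar x * expChar y := by
  rw [expChar, expChar, expChar, ← Complex.exp_add]
  push_cast
  ring_nf

theorem expChar_half : expChar (1 / 2) = -1 := by
  rw [expChar, ← Complex.exp_pi_mul_I]
  congr 1
  push_cast
  ring

theorem expChar_quarter : expChar (1 / 4) = Complex.I := by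
  rw [expChar, show 2 * (Real.pi : ℂ) * Complex.I * ((1 / 4 : ℝ) : ℂ) = Real.pi / 2 * Complex.I by
    push_cast; ring, Complex.exp_pi_div_two_mul_I]

theorem periodic_expChar : Function.Periodic expChar 1 := by
  intro x
  rw [show x + 1 = x + 1 / 2 + 1 / 2 by ring, expChar_add, expChar_add, expChar_half]
  ring

/-- Rotation invariance of the uniform law on the circle. A half turn kills odd moments, and a
quarter turn exchanges real and imaginary parts, which gives the second moment. -/
theorem integral_expChar_shift (g : ℂ → ℝ) (c : ℝ) :
    ∫ t in (0 : ℝ)..1, g (expChar (t + c)) = ∫ t in (0 : ℝ)..1, g (expChar t) := by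
  have hp : Function.Periodic (fun t => g (expChar t)) 1 := fun t => by
    simp only [periodic_expChar t]
  rw [intervalIntegral.integral_comp_add_right (fun t => g (expChar t))]
  have := hp.intervalIntegral_add_eq c 0
  rw [zero_add] at this
  rw [zero_add, add_comm 1 c, this]

theorem hasProjMoments_steinhaus {Ω : Type*} [MeasurableSpace Ω] {ξ : Ω → ℂ} {P : Measure Ω}
    (h : HasLaw ξ steinhausLaw P) : HasProjMoments 0 ξ P := by
  have hint : ∀ g : ℂ → ℝ, Continuous g →
      ∫ ω, g (ξ ω) ∂P = ∫ t in (0 : ℝ)..1, g (expChar t) := by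
    intro g hg
    have := h.integral_comp (f := g) hg.measurable.aestronglyMeasurable
    rw [Function.comp_def] at this
    rw [this, steinhausLaw, integral_map continuous_expChar.aemeasurable
      hg.measurable.aestronglyMeasurable, intervalIntegral.integral_of_le zero_le_one,
      integral_Icc_eq_integral_Ioc]
  have hodd : ∀ g : ℂ → ℝ, Continuous g → (∀ x, g (-x) = -g x) → ∫ ω, g (ξ ω) ∂P = 0 := by
    intro g hg ho
    rw [hint g hg]
    have := integral_expChar_shift g (1 / 2)
    simp only [expChar_add, expChar_half, mul_neg_one, ho, intervalIntegral.integral_neg] at this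
    linarith
  have hc : ∀ z : ℂ, Continuous fun x : ℂ => (z * x).re := fun z => by fun_prop
  refine ⟨h.aemeasurable, ?_, fun z => ?_, fun z => ?_, fun z => ?_⟩
  · rw [h.ae_iff measurable_norm_eq_one, steinhausLaw,
      ae_map_iff continuous_expChar.aemeasurable (measurableSet_setOfPred.2 measurable_norm_eq_one)]
    exact Eventually.of_forall norm_expChar
  · exact hodd _ (hc z) (by simp)
  · rw [hint (fun x => (z * x).re ^ 2) ((hc z).pow 2)]
    have h1 := integral_expChar_shift (fun x => (z * x).re ^ 2) (1 / 4)
    have h2 : ∀ t, (z * expChar (t + 1 / 4)).re ^ 2 = ‖z‖ ^ 2 - (z * expChar t).re ^ 2 := by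
      intro t
      have h3 : ‖z‖ ^ 2 = ‖z * expChar t‖ ^ 2 := by rw [norm_mul, norm_expChar, mul_one]
      rw [h3, expChar_add, expChar_quarter, ← mul_assoc, Complex.mul_I_re, Complex.sq_norm,
        Complex.normSq_apply]
      ring
    have hcc : Continuous fun t => (z * expChar t).re ^ 2 :=
      ((hc z).comp continuous_expChar).pow 2
    simp only [h2] at h1
    rw [intervalIntegral.integral_sub (by simp) (hcc.intervalIntegrable 0 1)] at h1
    rw [intervalIntegral.integral_const, sub_zero, one_smul] at h1
    rw [quadForm]
    linarith
  · exact hodd _ ((hc z).pow 3) (by intro x; simp; ring)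

/-! ### Harmonic analysis modulo `M` -/

/-- The average over one period `0 ≤ j < M`. -/
noncomputable def cycAvg (M : ℕ) : (ℕ → ℂ) →ₗ[ℂ] ℂ :=
  (M : ℂ)⁻¹ • ∑ j ∈ Finset.range M, LinearMap.proj j

theorem cycAvg_apply (M : ℕ) (g : ℕ → ℂ) :
    cycAvg M g = (M : ℂ)⁻¹ * ∑ j ∈ Finset.range M, g j := by
  simp [cycAvg, LinearMap.sum_apply]

theorem cycAvg_ofReal (M : ℕ) (g : ℕ → ℝ) :
    cycAvg M (fun j => (g j : ℂ)) = (((M : ℝ)⁻¹ * ∑ j ∈ Finset.range M, g j : ℝ) : ℂ) := by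
  rw [cycAvg_apply]; push_cast; rfl

/-- The character `j ↦ e(k j / M)`. -/
noncomputable def cycChar (M : ℕ) (k : ℤ) : ℕ → ℂ := fun j => expChar (k * (j / M))

theorem cycChar_add (M : ℕ) (k l : ℤ) : cycChar M (k + l) = cycChar M k * cycChar M l := by
  funext j
  rw [Pi.mul_apply, cycChar, cycChar, cycChar, ← expChar_add]
  push_cast
  ring_nf

theorem conj_expChar (x : ℝ) : (starRingEnd ℂ) (expChar x) = expChar (-x) := by
  rw [expChar, expChar, ← Complex.exp_conj]
  simp [mul_comm, mul_left_comm, Complex.conj_ofReal, map_ofNat]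

theorem star_cycChar (M : ℕ) (k : ℤ) : star (cycChar M k) = cycChar M (-k) := by
  funext j
  rw [Pi.star_apply, cycChar, cycChar, RCLike.star_def, conj_expChar]
  push_cast
  ring_nf

theorem expChar_intCast (k : ℤ) : expChar k = 1 := by
  rw [expChar, ← Complex.exp_int_mul_two_pi_mul_I k]
  congr 1
  push_cast
  ring

theorem expChar_natCast_mul (n : ℕ) (x : ℝ) : expChar (n * x) = expChar x ^ n := by
  rw [expChar, expChar, ← Complex.exp_nat_mul]
  congr 1
  push_cast
  ring

theorem cycAvg_cycChar {M : ℕ} {k : ℤ} (hk : |k| < M) :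
    cycAvg M (cycChar M k) = if k = 0 then 1 else 0 := by
  have hM : (0 : ℤ) < M := (abs_nonneg k).trans_lt hk
  have hM0 : (M : ℂ) ≠ 0 := by exact_mod_cast hM.ne'
  have hMr : (M : ℝ) ≠ 0 := by exact_mod_cast hM.ne'
  rw [cycAvg_apply]
  split_ifs with h
  · simp [h, cycChar, expChar, hM0]
  · have hpow : ∀ j, cycChar M k j = expChar (k / M) ^ j := by
      intro j
      rw [← expChar_natCast_mul, cycChar]
      congr 1; ring
    simp only [hpow]
    have h1 : expChar (k / M) ^ M = 1 := by
      rw [← expChar_natCast_mul, mul_div_cancel₀ _ hMr, expChar_intCast]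
    have h2 : expChar (k / M) ≠ 1 := by
      intro he
      rw [expChar, Complex.exp_eq_one_iff] at he
      obtain ⟨n, hn⟩ := he
      have hn' : ((k : ℝ) / M : ℂ) = n := by
        have := Complex.two_pi_I_ne_zero
        have h3 : (2 * Real.pi * Complex.I) * (((k / M : ℝ)) : ℂ) = (2 * Real.pi * Complex.I) * n := by
          rw [hn]; ring
        have := mul_left_cancel₀ this h3
        push_cast at this ⊢
        exact this
      rw [div_eq_iff hM0] at hn'
      have hkn : k = n * M := by exact_mod_cast hn'
      have hn0 : n ≠ 0 := by rintro rfl; simp at hkn; exact h hkn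
      rw [hkn, abs_mul, abs_of_pos hM] at hk
      have : 1 ≤ |n| := Int.one_le_abs hn0
      nlinarith
    rw [geom_sum_eq h2, h1]
    simp

/-- Trigonometric polynomials modulo `M` whose frequencies are multiples of `p` of absolute value
at most `d`. -/
noncomputable def trigSpan (M p d : ℕ) : Submodule ℂ (ℕ → ℂ) :=
  Submodule.span ℂ {g | ∃ k : ℤ, |k * p| ≤ d ∧ g = cycChar M (k * p)}

theorem cycChar_mem_trigSpan {M p d : ℕ} {k : ℤ} (h : |k * p| ≤ d) :
    cycChar M (k * p) ∈ trigSpan M p d :=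
  Submodule.subset_span ⟨k, h, rfl⟩

theorem mul_mem_trigSpan {M p d d' : ℕ} {g h : ℕ → ℂ} (hg : g ∈ trigSpan M p d)
    (hh : h ∈ trigSpan M p d') : g * h ∈ trigSpan M p (d + d') := by
  have := Submodule.mul_mem_mul hg hh
  rw [trigSpan, trigSpan, Submodule.span_mul_span] at this
  refine Submodule.span_le.2 ?_ this
  rintro _ ⟨_, ⟨k, hk, rfl⟩, _, ⟨l, hl, rfl⟩, rfl⟩
  simp only
  rw [← cycChar_add, ← add_mul]
  refine cycChar_mem_trigSpan ?_
  rw [add_mul]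
  push_cast
  exact (abs_add_le _ _).trans (add_le_add hk hl)

theorem star_mem_trigSpan {M p d : ℕ} {g : ℕ → ℂ} (hg : g ∈ trigSpan M p d) :
    star g ∈ trigSpan M p d := by
  induction hg using Submodule.span_induction with
  | mem x hx =>
    obtain ⟨k, hk, rfl⟩ := hx
    rw [star_cycChar, ← neg_mul]
    exact cycChar_mem_trigSpan (by rwa [neg_mul, abs_neg])
  | zero => rw [star_zero]; exact Submodule.zero_mem _
  | add x y _ _ hx hy => rw [star_add]; exact Submodule.add_mem _ hx hy
  | smul a x _ hx => rw [star_smul]; exact Submodule.smul_mem _ _ hx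

/-- As `2 * d < M` there is no aliasing, so only a coincidence `k p + l q = 0` could correlate the
two factors. It forces `q ∣ k`, and then `|k p| ≥ p q > d` unless `k = 0`. -/
theorem cycAvg_mul {M p q d : ℕ} (hp : p.Prime) (hq : q.Prime) (hpq : p ≠ q) (hd : d < p * q)
    (hM : 2 * d < M) {g h : ℕ → ℂ} (hg : g ∈ trigSpan M p d) (hh : h ∈ trigSpan M q d) :
    cycAvg M (g * h) = cycAvg M g * cycAvg M h := by
  induction hg, hh using Submodule.span_induction₂ with
  | mem_mem x y hx hy =>
    obtain ⟨k, hk, rfl⟩ := hx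
    obtain ⟨l, hl, rfl⟩ := hy
    have hM' : 2 * (d : ℤ) < M := by exact_mod_cast hM
    have hd0 : (0 : ℤ) ≤ d := Int.natCast_nonneg d
    have hp0 : (p : ℤ) ≠ 0 := by exact_mod_cast hp.ne_zero
    have hq0 : (q : ℤ) ≠ 0 := by exact_mod_cast hq.ne_zero
    rw [← cycChar_add, cycAvg_cycChar (by linarith [abs_add_le (k * (p : ℤ)) (l * q)]),
      cycAvg_cycChar (by linarith), cycAvg_cycChar (by linarith)]
    by_cases hk0 : k = 0
    · simp [hk0]
    have hne : k * (p : ℤ) + l * q ≠ 0 := by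
      intro h0
      have hdvd : (q : ℤ) ∣ k * p := ⟨-l, by linarith⟩
      have hcop : IsCoprime (q : ℤ) p :=
        Nat.isCoprime_iff_coprime.2 ((Nat.coprime_primes hq hp).2 hpq.symm)
      obtain ⟨m, rfl⟩ := hcop.dvd_of_dvd_mul_right hdvd
      have hm0 : m ≠ 0 := by rintro rfl; simp at hk0
      have h1 : 1 ≤ |m| := Int.one_le_abs hm0
      rw [abs_mul, abs_mul, Nat.abs_cast, Nat.abs_cast] at hk
      have hd' : (d : ℤ) < p * q := by exact_mod_cast hd
      have : (0 : ℤ) ≤ p * q := by positivity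
      nlinarith
    rw [if_neg hne, if_neg (mul_ne_zero hk0 hp0), zero_mul]
  | zero_left y hy => simp
  | zero_right x hx => simp
  | add_left x y z _ _ _ h1 h2 => rw [add_mul, map_add, h1, h2, map_add, add_mul]
  | add_right x y z _ _ _ h1 h2 => rw [mul_add, map_add, h1, h2, map_add, mul_add]
  | smul_left r x y _ _ h1 =>
    rw [smul_mul_assoc, map_smul, h1, map_smul, smul_eq_mul, smul_eq_mul, mul_assoc]
  | smul_right r x y _ _ h1 =>
    rw [mul_smul_comm, map_smul, h1, map_smul, smul_eq_mul, smul_eq_mul]; ring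

/-- The variance of a sum of pairwise uncorrelated trigonometric polynomials. -/
theorem sum_sq_sum_eq {M d : ℕ} {S : Finset ℕ} (hM : 2 * d < M) (hS : ∀ p ∈ S, p.Prime)
    (hSd : ∀ p ∈ S, ∀ q ∈ S, d < p * q) (u : ℕ → ℕ → ℝ)
    (hu : ∀ p ∈ S, (fun j => (u p j : ℂ)) ∈ trigSpan M p d)
    (hu0 : ∀ p ∈ S, ∑ j ∈ Finset.range M, u p j = 0) :
    ∑ j ∈ Finset.range M, (∑ p ∈ S, u p j) ^ 2 = ∑ p ∈ S, ∑ j ∈ Finset.range M, u p j ^ 2 := by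
  have hM0 : (M : ℝ)⁻¹ ≠ 0 := inv_ne_zero (by exact_mod_cast (by omega : M ≠ 0))
  have hcross : ∀ p ∈ S, ∀ q ∈ S, p ≠ q → ∑ j ∈ Finset.range M, u p j * u q j = 0 := by
    intro p hp q hq hpq
    have h := cycAvg_mul (hS p hp) (hS q hq) hpq (hSd p hp q hq) hM (hu p hp) (hu q hq)
    have e : (fun j => (u p j : ℂ)) * (fun j => (u q j : ℂ)) =
        fun j => ((u p j * u q j : ℝ) : ℂ) := by
      funext j; simp
    rw [e, cycAvg_ofReal, cycAvg_ofReal, hu0 p hp, mul_zero, Complex.ofReal_zero, zero_mul] at h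
    exact (mul_eq_zero.1 (Complex.ofReal_eq_zero.1 h)).resolve_left hM0
  have : ∀ j, (∑ p ∈ S, u p j) ^ 2 = ∑ p ∈ S, ∑ q ∈ S, u p j * u q j := by
    intro j; rw [pow_two, Finset.sum_mul_sum]
  simp only [this]
  rw [Finset.sum_comm]
  refine Finset.sum_congr rfl fun p hp => ?_
  rw [Finset.sum_comm, Finset.sum_eq_single p]
  · simp only [pow_two]
  · exact fun q hq hne => hcross p hp q hq hne.symm
  · exact fun h => absurd hp h

/-- `∑ n ∈ s, c n e(ν n j / M)`. -/
noncomputable def cycPoly (M : ℕ) (s : Finset ℕ) (c : ℕ → ℂ) (ν : ℕ → ℕ) (j : ℕ) : ℂ :=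
  ∑ n ∈ s, c n * cycChar M (ν n) j

theorem cycPoly_eq_sum_smul (M : ℕ) (s : Finset ℕ) (c : ℕ → ℂ) (ν : ℕ → ℕ) :
    cycPoly M s c ν = ∑ n ∈ s, c n • cycChar M (ν n) := by
  funext j; simp [cycPoly, Finset.sum_apply]

theorem cycAvg_cycPoly {M : ℕ} {s : Finset ℕ} {c : ℕ → ℂ} {ν : ℕ → ℕ}
    (h0 : ∀ n ∈ s, 0 < ν n) (hM : ∀ n ∈ s, ν n < M) : cycAvg M (cycPoly M s c ν) = 0 := by
  rw [cycPoly_eq_sum_smul, map_sum]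
  refine Finset.sum_eq_zero fun n hn => ?_
  rw [map_smul, cycAvg_cycChar (by rw [Nat.abs_cast]; exact_mod_cast hM n hn),
    if_neg (by exact_mod_cast (h0 n hn).ne'), smul_zero]

/-- Sums of two positive frequencies stay strictly between `0` and `M`. Consequently the part of
`quadForm` carrying `κ` averages to zero, and both models have the same mean variance formula. -/
theorem cycAvg_cycPoly_sq {M : ℕ} {s : Finset ℕ} {c : ℕ → ℂ} {ν : ℕ → ℕ}
    (h0 : ∀ n ∈ s, 0 < ν n) (hM : ∀ n ∈ s, 2 * ν n < M) :
    cycAvg M (cycPoly M s c ν * cycPoly M s c ν) = 0 := by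
  rw [cycPoly_eq_sum_smul, Finset.sum_mul_sum, map_sum]
  refine Finset.sum_eq_zero fun n hn => ?_
  rw [map_sum]
  refine Finset.sum_eq_zero fun m hm => ?_
  have := h0 n hn
  have := hM n hn
  have := hM m hm
  rw [smul_mul_smul_comm, ← cycChar_add, map_smul, ← Nat.cast_add, cycAvg_cycChar, if_neg,
    smul_zero]
  · exact_mod_cast (by omega)
  · rw [Nat.abs_cast]; exact_mod_cast (by omega)

theorem cycAvg_cycPoly_mul_star {M : ℕ} {s : Finset ℕ} {c : ℕ → ℂ} {ν : ℕ → ℕ}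
    (hν : Set.InjOn ν s) (hM : ∀ n ∈ s, ν n < M) :
    cycAvg M (cycPoly M s c ν * star (cycPoly M s c ν)) = ((∑ n ∈ s, ‖c n‖ ^ 2 : ℝ) : ℂ) := by
  rw [cycPoly_eq_sum_smul, star_sum, Finset.sum_mul_sum, map_sum, Complex.ofReal_sum]
  refine Finset.sum_congr rfl fun n hn => ?_
  have hav : ∀ m ∈ s, cycAvg M (c n • cycChar M (ν n) * star (c m • cycChar M (ν m))) =
      c n * star (c m) * if n = m then 1 else 0 := by
    intro m hm
    have h1 := hM n hn
    have h2 := hM m hm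
    rw [star_smul, star_cycChar, smul_mul_smul_comm, ← cycChar_add, map_smul,
      cycAvg_cycChar (by rw [abs_lt]; constructor <;> omega), smul_eq_mul]
    congr 1
    by_cases h : n = m
    · simp [h]
    · rw [if_neg h, if_neg]
      intro h'
      exact h (hν hn hm (by omega))
  rw [map_sum, Finset.sum_congr rfl hav]
  simp only [mul_ite, mul_one, mul_zero, Finset.sum_ite_eq, if_pos hn]
  rw [RCLike.star_def, Complex.mul_conj, Complex.normSq_eq_norm_sq]

theorem sum_norm_sq_cycPoly {M : ℕ} {s : Finset ℕ} {c : ℕ → ℂ} {ν : ℕ → ℕ}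
    (hν : Set.InjOn ν s) (hM : ∀ n ∈ s, ν n < M) :
    ∑ j ∈ Finset.range M, ‖cycPoly M s c ν j‖ ^ 2 = M * ∑ n ∈ s, ‖c n‖ ^ 2 := by
  rcases Nat.eq_zero_or_pos M with rfl | hM0
  · simp
  have h := cycAvg_cycPoly_mul_star (c := c) hν hM
  have e : cycPoly M s c ν * star (cycPoly M s c ν) =
      fun j => ((‖cycPoly M s c ν j‖ ^ 2 : ℝ) : ℂ) := by
    funext j
    rw [Pi.mul_apply, Pi.star_apply, RCLike.star_def, Complex.mul_conj, Complex.normSq_eq_norm_sq]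
  rw [e, cycAvg_ofReal] at h
  have h' := Complex.ofReal_injective h
  have : (M : ℝ) ≠ 0 := by positivity
  field_simp at h'
  linarith

theorem norm_cycPoly_le {M : ℕ} {s : Finset ℕ} {c : ℕ → ℂ} {ν : ℕ → ℕ} (hc : ∀ n ∈ s, ‖c n‖ ≤ 1)
    (j : ℕ) : ‖cycPoly M s c ν j‖ ≤ s.card := by
  rw [cycPoly]
  refine (norm_sum_le_of_le s (f := fun n => c n * cycChar M (ν n) j) (n := fun _ => 1)
    fun n hn => ?_).trans (by simp)
  rw [norm_mul, cycChar, norm_expChar, mul_one]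
  exact hc n hn

theorem cycPoly_mem_trigSpan {M p N : ℕ} {s : Finset ℕ} {c : ℕ → ℂ}
    (hs : ∀ m ∈ s, m * p ≤ N) : cycPoly M s c (fun m => m * p) ∈ trigSpan M p N := by
  rw [cycPoly_eq_sum_smul]
  refine Submodule.sum_mem _ fun m hm => Submodule.smul_mem _ _ ?_
  rw [Nat.cast_mul]
  refine cycChar_mem_trigSpan ?_
  rw [← Nat.cast_mul, Nat.abs_cast]
  exact_mod_cast hs m hm

theorem trigSpan_mono {M p d d' : ℕ} (h : d ≤ d') : trigSpan M p d ≤ trigSpan M p d' :=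
  Submodule.span_mono fun _ ⟨k, hk, e⟩ => ⟨k, hk.trans (by exact_mod_cast h), e⟩

/-! ### The coefficient polynomials of large primes, their variances and covariances -/

/-- `∑ m ≤ N / p, a m e(m p j / M)`: the coefficient of `f p` in the exponential sum. -/
noncomputable def primePoly (M N : ℕ) (a : ℕ → ℂ) (p j : ℕ) : ℂ :=
  cycPoly M (Finset.Icc 1 (N / p)) a (fun m => m * p) j

theorem mul_le_of_mem_Icc_div {N p m : ℕ} (hm : m ∈ Finset.Icc 1 (N / p)) : m * p ≤ N :=
  (Nat.mul_le_mul_right p (Finset.mem_Icc.1 hm).2).trans (Nat.div_mul_le_self N p)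

theorem primePoly_mem_trigSpan (M N : ℕ) (a : ℕ → ℂ) (p : ℕ) :
    primePoly M N a p ∈ trigSpan M p N :=
  cycPoly_mem_trigSpan fun _ hm => mul_le_of_mem_Icc_div hm

section

variable {M N : ℕ} {a : ℕ → ℂ}

theorem norm_primePoly_le (ha : ∀ n, ‖a n‖ ≤ 1) (p j : ℕ) : ‖primePoly M N a p j‖ ≤ N / p := by
  refine (norm_cycPoly_le (fun n _ => ha n) j).trans ?_
  rw [Nat.card_Icc, Nat.add_sub_cancel]
  exact Nat.cast_div_le

theorem injOn_mul_right {p : ℕ} (hp : p.Prime) (s : Set ℕ) : Set.InjOn (fun m => m * p) s :=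
  fun _ _ _ _ h => Nat.eq_of_mul_eq_mul_right hp.pos h

theorem sum_norm_sq_primePoly (hM : N < M) {p : ℕ} (hp : p.Prime) :
    ∑ j ∈ Finset.range M, ‖primePoly M N a p j‖ ^ 2 =
      M * ∑ m ∈ Finset.Icc 1 (N / p), ‖a m‖ ^ 2 :=
  sum_norm_sq_cycPoly (injOn_mul_right hp _) fun _ hm => (mul_le_of_mem_Icc_div hm).trans_lt hM

theorem sum_norm_sq_primePoly_le (ha : ∀ n, ‖a n‖ ≤ 1) (hM : N < M) {p : ℕ} (hp : p.Prime) :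
    ∑ j ∈ Finset.range M, ‖primePoly M N a p j‖ ^ 2 ≤ M * (N / p) := by
  rw [sum_norm_sq_primePoly hM hp]
  gcongr
  calc ∑ m ∈ Finset.Icc 1 (N / p), ‖a m‖ ^ 2 ≤ ∑ m ∈ Finset.Icc 1 (N / p), (1 : ℝ) := by
        refine Finset.sum_le_sum fun m _ => ?_
        exact pow_le_one₀ (norm_nonneg _) (ha m)
    _ = (N / p : ℕ) := by simp
    _ ≤ _ := Nat.cast_div_le

theorem quadForm_eq_star (κ : ℝ) (z : ℂ) :
    (quadForm κ z : ℂ) = (1 / 2 : ℂ) * (z * star z) + (κ / 4 : ℂ) * (z * z + star (z * z)) := by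
  rw [RCLike.star_def, Complex.mul_conj, Complex.normSq_eq_norm_sq,
    Complex.add_conj, quadForm, ← pow_two]
  push_cast
  ring

theorem quadForm_primePoly_mem_trigSpan (κ : ℝ) (p : ℕ) :
    (fun j => (quadForm κ (primePoly M N a p j) : ℂ)) ∈ trigSpan M p (2 * N) := by
  have hF := primePoly_mem_trigSpan M N a p
  have e : (fun j => (quadForm κ (primePoly M N a p j) : ℂ)) =
      (1 / 2 : ℂ) • (primePoly M N a p * star (primePoly M N a p)) +
      (κ / 4 : ℂ) • (primePoly M N a p * primePoly M N a p +
        star (primePoly M N a p * primePoly M N a p)) := by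
    funext j
    simp only [Pi.add_apply, Pi.smul_apply, Pi.mul_apply, Pi.star_apply, smul_eq_mul]
    exact quadForm_eq_star κ _
  rw [e, two_mul]
  exact Submodule.add_mem _ (Submodule.smul_mem _ _ (mul_mem_trigSpan hF (star_mem_trigSpan hF)))
    (Submodule.smul_mem _ _ (Submodule.add_mem _ (mul_mem_trigSpan hF hF)
      (star_mem_trigSpan (mul_mem_trigSpan hF hF))))

theorem sum_quadForm_primePoly (κ : ℝ) (hM : 2 * N < M) {p : ℕ} (hp : p.Prime) :
    ∑ j ∈ Finset.range M, quadForm κ (primePoly M N a p j) =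
      M * ((∑ m ∈ Finset.Icc 1 (N / p), ‖a m‖ ^ 2) / 2) := by
  have h1 := sum_norm_sq_primePoly (a := a) (by omega : N < M) hp
  have h2 : cycAvg M (primePoly M N a p * primePoly M N a p) = 0 := by
    refine cycAvg_cycPoly_sq (fun m hm => ?_) fun m hm => ?_
    · exact Nat.mul_pos (Finset.mem_Icc.1 hm).1 hp.pos
    · have := mul_le_of_mem_Icc_div hm
      omega
  have hM0 : (M : ℂ)⁻¹ ≠ 0 := inv_ne_zero (by exact_mod_cast (by omega : M ≠ 0))
  rw [cycAvg_apply] at h2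
  have h3 := (mul_eq_zero.1 h2).resolve_left hM0
  have h4 : ∑ j ∈ Finset.range M, (primePoly M N a p j ^ 2).re = 0 := by
    rw [← Complex.re_sum]
    simp only [Pi.mul_apply] at h3
    simp only [pow_two, h3, Complex.zero_re]
  simp only [quadForm]
  rw [← Finset.sum_div, Finset.sum_add_distrib, ← Finset.mul_sum, h4, h1]
  ring

theorem const_mem_trigSpan (M p d : ℕ) (c : ℂ) : (fun _ => c) ∈ trigSpan M p d := by
  have h := Submodule.smul_mem (trigSpan M p d) c
    (cycChar_mem_trigSpan (M := M) (p := p) (d := d) (k := 0) (by simp))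
  convert h using 1
  funext j
  simp [cycChar, expChar]

/-- The variances of the exponential sums concentrate around their mean. -/
theorem sum_sq_sum_quadForm_sub_le {κ : ℝ} (h0 : 0 ≤ κ) (h1 : κ ≤ 1) (ha : ∀ n, ‖a n‖ ≤ 1)
    (hM : 4 * N < M) {S : Finset ℕ} (hS : ∀ p ∈ S, p.Prime)
    (hSN : ∀ p ∈ S, ∀ q ∈ S, 2 * N < p * q) :
    ∑ j ∈ Finset.range M, (∑ p ∈ S, quadForm κ (primePoly M N a p j) -
      ∑ p ∈ S, (∑ m ∈ Finset.Icc 1 (N / p), ‖a m‖ ^ 2) / 2) ^ 2 ≤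
      M * ∑ p ∈ S, ((N : ℝ) / p) ^ 4 := by
  -- After centring, terms for different primes are uncorrelated, so only the individual variances
  -- remain. The degree has doubled to `2 * N`, hence the hypothesis `4 * N < M`.
  simp only [← Finset.sum_sub_distrib]
  rw [sum_sq_sum_eq (d := 2 * N) (by omega) hS hSN
    (fun p j => quadForm κ (primePoly M N a p j) - (∑ m ∈ Finset.Icc 1 (N / p), ‖a m‖ ^ 2) / 2)]
  · rw [Finset.mul_sum]
    refine Finset.sum_le_sum fun p hp => ?_
    have hs := sum_quadForm_primePoly (a := a) κ (by omega : 2 * N < M) (hS p hp)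
    set D := (∑ m ∈ Finset.Icc 1 (N / p), ‖a m‖ ^ 2) / 2
    have e : ∀ j, (quadForm κ (primePoly M N a p j) - D) ^ 2 =
        quadForm κ (primePoly M N a p j) ^ 2 - 2 * D * quadForm κ (primePoly M N a p j) + D ^ 2 :=
      fun j => by ring
    simp only [e]
    rw [Finset.sum_add_distrib, Finset.sum_sub_distrib, ← Finset.mul_sum, hs, Finset.sum_const,
      Finset.card_range, nsmul_eq_mul]
    have hb : ∑ j ∈ Finset.range M, quadForm κ (primePoly M N a p j) ^ 2 ≤
        ∑ j ∈ Finset.range M, ((N : ℝ) / p) ^ 4 := by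
      refine Finset.sum_le_sum fun j _ => ?_
      have q0 := quadForm_nonneg h0 h1 (primePoly M N a p j)
      have q1 := (quadForm_le h0 h1 (primePoly M N a p j)).trans
        (pow_le_pow_left₀ (norm_nonneg _) (norm_primePoly_le ha p j) 2)
      calc _ ≤ (((N : ℝ) / p) ^ 2) ^ 2 := by gcongr
        _ = _ := by ring
    rw [Finset.sum_const, Finset.card_range, nsmul_eq_mul] at hb
    have : 0 ≤ (M : ℝ) * D ^ 2 := by positivity
    linarith
  · intro p _
    have := Submodule.sub_mem _ (quadForm_primePoly_mem_trigSpan (M := M) (N := N) (a := a) κ p)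
      (const_mem_trigSpan M p (2 * N) (((∑ m ∈ Finset.Icc 1 (N / p), ‖a m‖ ^ 2) / 2 : ℝ) : ℂ))
    convert this using 1
    funext j
    simp
  · intro p hp
    rw [Finset.sum_sub_distrib, sum_quadForm_primePoly κ (by omega) (hS p hp), Finset.sum_const,
      Finset.card_range, nsmul_eq_mul, sub_self]

theorem bilinForm_eq_star (κ : ℝ) (z w : ℂ) :
    (bilinForm κ z w : ℂ) =
      (1 / 4 : ℂ) * ((star w + κ * w) * z + star (star w + κ * w) * star z) := by
  apply Complex.ext
  · simp [bilinForm]; ring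
  · simp [bilinForm]; ring

/-- The covariances of the exponential sums at two points are small in mean square. -/
theorem sum_sum_sq_sum_bilinForm_le {κ : ℝ} (h0 : 0 ≤ κ) (h1 : κ ≤ 1) (ha : ∀ n, ‖a n‖ ≤ 1)
    (hM : 4 * N < M) {S : Finset ℕ} (hS : ∀ p ∈ S, p.Prime)
    (hSN : ∀ p ∈ S, ∀ q ∈ S, 2 * N < p * q) :
    ∑ k ∈ Finset.range M, ∑ j ∈ Finset.range M,
      (∑ p ∈ S, bilinForm κ (primePoly M N a p j) (primePoly M N a p k)) ^ 2 ≤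
      M ^ 2 * ∑ p ∈ S, ((N : ℝ) / p) ^ 2 := by
  have step : ∀ k, ∑ j ∈ Finset.range M,
      (∑ p ∈ S, bilinForm κ (primePoly M N a p j) (primePoly M N a p k)) ^ 2 ≤
      ∑ p ∈ S, M * (N / p) * ‖primePoly M N a p k‖ ^ 2 := by
    intro k
    have hmem : ∀ p, (fun j => (bilinForm κ (primePoly M N a p j) (primePoly M N a p k) : ℂ)) =
        (1 / 4 : ℂ) • ((star (primePoly M N a p k) + κ * primePoly M N a p k) •
          primePoly M N a p + star (star (primePoly M N a p k) + κ * primePoly M N a p k) •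
          star (primePoly M N a p)) := by
      intro p
      funext j
      simp only [Pi.add_apply, Pi.smul_apply, Pi.star_apply, smul_eq_mul]
      exact bilinForm_eq_star κ _ _
    rw [sum_sq_sum_eq (d := 2 * N) (by omega) hS hSN
      (fun p j => bilinForm κ (primePoly M N a p j) (primePoly M N a p k))]
    · refine Finset.sum_le_sum fun p hp => ?_
      calc ∑ j ∈ Finset.range M, bilinForm κ (primePoly M N a p j) (primePoly M N a p k) ^ 2
          ≤ ∑ j ∈ Finset.range M, ‖primePoly M N a p j‖ ^ 2 * ‖primePoly M N a p k‖ ^ 2 := by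
            refine Finset.sum_le_sum fun j _ => ?_
            rw [← sq_abs, ← mul_pow]
            gcongr
            exact abs_bilinForm_le h0 h1 _ _
        _ ≤ _ := by
            rw [← Finset.sum_mul]
            gcongr
            exact sum_norm_sq_primePoly_le ha (by omega) (hS p hp)
    · intro p _
      have hF := trigSpan_mono (by omega : N ≤ 2 * N) (primePoly_mem_trigSpan M N a p)
      rw [hmem]
      exact Submodule.smul_mem _ _ (Submodule.add_mem _ (Submodule.smul_mem _ _ hF)
        (Submodule.smul_mem _ _ (star_mem_trigSpan hF)))
    · intro p hp
      have hsum : ∑ j ∈ Finset.range M, primePoly M N a p j = 0 := by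
        have h2 : cycAvg M (primePoly M N a p) = 0 := by
          refine cycAvg_cycPoly (fun m hm => ?_) fun m hm => ?_
          · exact Nat.mul_pos (Finset.mem_Icc.1 hm).1 (hS p hp).pos
          · have := mul_le_of_mem_Icc_div hm
            omega
        rw [cycAvg_apply] at h2
        exact (mul_eq_zero.1 h2).resolve_left
          (inv_ne_zero (by exact_mod_cast (by omega : M ≠ 0)))
      simp only [bilinForm]
      rw [← Finset.sum_div, Finset.sum_add_distrib, ← Finset.mul_sum, ← Complex.re_sum,
        ← Complex.re_sum, ← Finset.sum_mul, ← Finset.sum_mul, hsum]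
      simp
  calc _ ≤ ∑ k ∈ Finset.range M, ∑ p ∈ S, M * (N / p) * ‖primePoly M N a p k‖ ^ 2 :=
        Finset.sum_le_sum fun k _ => step k
    _ = ∑ p ∈ S, M * (N / p) * ∑ k ∈ Finset.range M, ‖primePoly M N a p k‖ ^ 2 := by
        rw [Finset.sum_comm]
        simp only [Finset.mul_sum]
    _ ≤ ∑ p ∈ S, M * (N / p) * (M * ((N : ℝ) / p)) := by
        refine Finset.sum_le_sum fun p hp => ?_
        gcongr
        exact sum_norm_sq_primePoly_le ha (by omega) (hS p hp)
    _ = _ := by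
        rw [Finset.mul_sum]
        refine Finset.sum_congr rfl fun p _ => by ring

end

/-! ### Exponential moments of independent sums and the second moment method -/

section

variable {Ω : Type*} [MeasurableSpace Ω] {P : Measure Ω}

section product

variable {ι : Type*} [Fintype ι] {κ : ℝ} {ξ : ι → Ω → ℂ}

theorem integral_exp_sum_eq_prod (hind : iIndepFun ξ P) (hξ : ∀ i, HasProjMoments κ (ξ i) P)
    (z : ι → ℂ) :
    ∫ ω, Real.exp (∑ i, (z i * ξ i ω).re) ∂P = ∏ i, ∫ ω, Real.exp (z i * ξ i ω).re ∂P := by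
  simp only [Real.exp_sum]
  exact hind.integral_fun_prod_comp (f := fun i x => Real.exp (z i * x).re)
    (fun i => (hξ i).aemeasurable)
    (fun i => Continuous.aestronglyMeasurable (by fun_prop))

variable [IsProbabilityMeasure P]

theorem integral_exp_sum_le (hind : iIndepFun ξ P) (hξ : ∀ i, HasProjMoments κ (ξ i) P)
    {z : ι → ℂ} (hz : ∀ i, ‖z i‖ ≤ 1) :
    ∫ ω, Real.exp (∑ i, (z i * ξ i ω).re) ∂P ≤
      Real.exp ((∑ i, quadForm κ (z i)) / 2 + ∑ i, ‖z i‖ ^ 4) := by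
  rw [integral_exp_sum_eq_prod hind hξ, Finset.sum_div, ← Finset.sum_add_distrib, Real.exp_sum]
  exact Finset.prod_le_prod (fun i _ => integral_nonneg fun _ => (Real.exp_pos _).le)
    fun i _ => (hξ i).integral_exp_le (hz i)

theorem le_integral_exp_sum (hκ0 : 0 ≤ κ) (hκ1 : κ ≤ 1) (hind : iIndepFun ξ P)
    (hξ : ∀ i, HasProjMoments κ (ξ i) P) {z : ι → ℂ} (hz : ∀ i, ‖z i‖ ≤ 1 / 2) :
    Real.exp ((∑ i, quadForm κ (z i)) / 2 - ∑ i, ‖z i‖ ^ 4) ≤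
      ∫ ω, Real.exp (∑ i, (z i * ξ i ω).re) ∂P := by
  rw [integral_exp_sum_eq_prod hind hξ, Finset.sum_div, ← Finset.sum_sub_distrib, Real.exp_sum]
  exact Finset.prod_le_prod (fun i _ => (Real.exp_pos _).le)
    fun i _ => (hξ i).le_integral_exp hκ0 hκ1 (hz i)

end product

/-- Second moment method: if the exponential moments of `R j` and `R j + R k` are nearly those
of Gaussian variables with few large covariances, then some `R j` is large. -/
theorem measure_forall_lt_le [IsProbabilityMeasure P] {ι : Type*} [DecidableEq ι]
    {G : Finset ι} (hG : G.Nonempty)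
    {R : ι → Ω → ℝ} (hRm : ∀ j ∈ G, AEMeasurable (R j) P) {B : ℝ}
    (hRB : ∀ j ∈ G, ∀ᵐ ω ∂P, R j ω ≤ B) {w : ι → ℝ} {c : ι → ι → ℝ} {w₀ ε ρ : ℝ}
    (hε0 : 0 ≤ ε) (hε : ε ≤ 1 / 10)
    (hlow : ∀ j ∈ G, Real.exp (w j - ε) ≤ ∫ ω, Real.exp (R j ω) ∂P)
    (hup : ∀ j ∈ G, ∀ k ∈ G,
      ∫ ω, Real.exp (R j ω + R k ω) ∂P ≤ Real.exp (w j + w k + c j k + ε))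
    (hw : ∀ j ∈ G, |w j - w₀| ≤ ε) (hc : ∀ j ∈ G, ∀ k ∈ G, c j k ≤ w j + w k)
    (hbad : (((G ×ˢ G).filter fun x => ε < c x.1 x.2).card : ℝ) ≤ ρ * (G.card : ℝ) ^ 2)
    (hρ : ρ * Real.exp (2 * w₀) ≤ ε) :
    P {ω | ∀ j ∈ G, R j ω < w₀ - 2} ≤ ENNReal.ofReal (36 * ε) := by
  have hg : (0 : ℝ) < G.card := by exact_mod_cast hG.card_pos
  set Z : Ω → ℝ := fun ω => ∑ j ∈ G, Real.exp (R j ω) with hZ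
  have hZm : AEMeasurable Z P := Finset.aemeasurable_fun_sum G fun j hj => (hRm j hj).exp
  have hint : ∀ j ∈ G, Integrable (fun ω => Real.exp (R j ω)) P := by
    intro j hj
    refine Integrable.of_bound (hRm j hj).exp.aestronglyMeasurable (Real.exp B) ?_
    filter_upwards [hRB j hj] with ω hω
    rw [Real.norm_eq_abs, Real.abs_exp]
    exact Real.exp_le_exp.2 hω
  have hint2 : ∀ j ∈ G, ∀ k ∈ G, Integrable (fun ω => Real.exp (R j ω + R k ω)) P := by
    intro j hj k hk
    refine Integrable.of_bound ((hRm j hj).add (hRm k hk)).exp.aestronglyMeasurable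
      (Real.exp (B + B)) ?_
    filter_upwards [hRB j hj, hRB k hk] with ω h1 h2
    rw [Real.norm_eq_abs, Real.abs_exp]
    exact Real.exp_le_exp.2 (add_le_add h1 h2)
  have hZ2 : ∀ ω, Z ω ^ 2 = ∑ j ∈ G, ∑ k ∈ G, Real.exp (R j ω + R k ω) := by
    intro ω
    simp only [hZ, pow_two, Finset.sum_mul_sum, Real.exp_add]
  have hZ2int : Integrable (fun ω => Z ω ^ 2) P := by
    simp only [hZ2]
    exact integrable_finsetSum _ fun j hj => integrable_finsetSum _ fun k hk => hint2 j hj k hk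
  have hLp : MemLp Z 2 P := (memLp_two_iff_integrable_sq hZm.aestronglyMeasurable).2 hZ2int
  set m := ∫ ω, Z ω ∂P with hm
  have hm_eq : m = ∑ j ∈ G, ∫ ω, Real.exp (R j ω) ∂P := integral_finsetSum _ hint
  set T := ∑ j ∈ G, Real.exp (w j) with hT
  have hmT : Real.exp (-ε) * T ≤ m := by
    rw [hm_eq, hT, Finset.mul_sum]
    refine Finset.sum_le_sum fun j hj => ?_
    rw [← Real.exp_add, neg_add_eq_sub]
    exact hlow j hj
  have hTg : G.card * Real.exp (w₀ - ε) ≤ T := by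
    rw [hT, ← nsmul_eq_mul, ← Finset.sum_const]
    refine Finset.sum_le_sum fun j hj => Real.exp_le_exp.2 ?_
    linarith [(abs_le.1 (hw j hj)).1]
  have hT0 : 0 < T := lt_of_lt_of_le (by positivity) hTg
  have hm0 : 0 < m := lt_of_lt_of_le (by positivity) hmT
  have hTm : T ≤ Real.exp ε * m := by
    calc T = Real.exp ε * (Real.exp (-ε) * T) := by
          rw [← mul_assoc, ← Real.exp_add, add_neg_cancel, Real.exp_zero, one_mul]
      _ ≤ _ := by gcongr
  -- Pairs with `c j k ≤ ε` contribute almost exactly `T^2`. The others, diagonal included, are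
  -- bounded through `c j k ≤ w j + w k` and are few.
  have hsecond : ∫ ω, Z ω ^ 2 ∂P ≤ Real.exp (2 * ε) * T ^ 2 +
      ρ * G.card ^ 2 * Real.exp (4 * w₀ + 5 * ε) := by
    simp only [hZ2]
    rw [integral_finsetSum _ fun j hj => integrable_finsetSum _ fun k hk => hint2 j hj k hk]
    have h1 : ∀ j ∈ G, ∫ ω, ∑ k ∈ G, Real.exp (R j ω + R k ω) ∂P ≤
        ∑ k ∈ G, (Real.exp (2 * ε) * (Real.exp (w j) * Real.exp (w k)) +
          if ε < c j k then Real.exp (4 * w₀ + 5 * ε) else 0) := by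
      intro j hj
      rw [integral_finsetSum _ fun k hk => hint2 j hj k hk]
      refine Finset.sum_le_sum fun k hk => (hup j hj k hk).trans ?_
      split_ifs with h
      · refine le_add_of_nonneg_of_le (by positivity) (Real.exp_le_exp.2 ?_)
        linarith [hc j hj k hk, (abs_le.1 (hw j hj)).2, (abs_le.1 (hw k hk)).2]
      · rw [add_zero, ← Real.exp_add, ← Real.exp_add]
        exact Real.exp_le_exp.2 (by linarith)
    refine (Finset.sum_le_sum h1).trans ?_
    simp only [Finset.sum_add_distrib, ← Finset.mul_sum]
    rw [← Finset.sum_product', ← Finset.sum_mul, ← hT, ← pow_two]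
    gcongr
    rw [← Finset.sum_filter, Finset.sum_const, nsmul_eq_mul]
    gcongr
  -- Correlated pairs have size `exp (4 * w₀)` against the `exp (2 * w₀)` in `m^2`; the hypothesis
  -- on `ρ` pays for the ratio.
  have hbound : ρ * G.card ^ 2 * Real.exp (4 * w₀ + 5 * ε) ≤ ε * Real.exp (9 * ε) * m ^ 2 := by
    have h1 : G.card * Real.exp (w₀ - 2 * ε) ≤ m := by
      refine le_trans ?_ hmT
      calc G.card * Real.exp (w₀ - 2 * ε) = Real.exp (-ε) * (G.card * Real.exp (w₀ - ε)) := by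
            rw [mul_left_comm, ← Real.exp_add]; ring_nf
        _ ≤ _ := by gcongr
    have e : ρ * G.card ^ 2 * Real.exp (4 * w₀ + 5 * ε) = (ρ * Real.exp (2 * w₀)) *
        Real.exp (9 * ε) * (G.card * Real.exp (w₀ - 2 * ε)) ^ 2 := by
      have : Real.exp (4 * w₀ + 5 * ε) = Real.exp (2 * w₀) * Real.exp (9 * ε) *
          Real.exp (w₀ - 2 * ε) ^ 2 := by
        rw [pow_two, ← Real.exp_add, ← Real.exp_add, ← Real.exp_add]; ring_nf
      rw [this]; ring
    rw [e]
    gcongr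
  have hvar : variance Z P ≤ 9 * ε * m ^ 2 := by
    rw [variance_eq_sub hLp]
    have e1 : Real.exp (2 * ε) * T ^ 2 ≤ Real.exp (4 * ε) * m ^ 2 := by
      calc _ ≤ Real.exp (2 * ε) * (Real.exp ε * m) ^ 2 := by gcongr
        _ = _ := by
          rw [mul_pow, ← mul_assoc, pow_two (Real.exp ε), ← Real.exp_add, ← Real.exp_add]
          ring_nf
    have e2 : Real.exp (4 * ε) ≤ 1 + 6 * ε := by
      have := (abs_le.1 (Real.abs_exp_sub_one_sub_id_le (x := 4 * ε)
        (by rw [abs_of_nonneg] <;> linarith))).2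
      nlinarith
    have e3 : Real.exp (9 * ε) ≤ 3 :=
      (Real.exp_le_exp.2 (by linarith : 9 * ε ≤ 1)).trans Real.exp_one_lt_three.le
    have e4 : (∫ ω, (Z ^ 2) ω ∂P) ≤ (1 + 6 * ε) * m ^ 2 + ε * 3 * m ^ 2 := by
      refine hsecond.trans (add_le_add (e1.trans (by gcongr)) (hbound.trans (by gcongr)))
    linarith
  -- Chebyshev at distance `m / 2` turns the variance bound `9 * ε * m^2` into probability `36 * ε`.
  -- If every `R j` were below `w₀ - 2`, then `Z ≤ m / 2`.
  have hcheb := meas_ge_le_variance_div_sq hLp (half_pos hm0)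
  refine (measure_mono fun ω hω => ?_).trans (hcheb.trans (ENNReal.ofReal_le_ofReal ?_))
  · simp only [Set.mem_ofPred_eq] at hω ⊢
    rw [← hm]
    have h1 : Z ω ≤ G.card * Real.exp (w₀ - 2) := by
      rw [hZ, ← nsmul_eq_mul, ← Finset.sum_const]
      exact Finset.sum_le_sum fun j hj => Real.exp_le_exp.2 (hω j hj).le
    have h2 : G.card * Real.exp (w₀ - 2 * ε) ≤ m := by
      refine le_trans ?_ hmT
      calc G.card * Real.exp (w₀ - 2 * ε) = Real.exp (-ε) * (G.card * Real.exp (w₀ - ε)) := by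
            rw [mul_left_comm, ← Real.exp_add]; ring_nf
        _ ≤ _ := by gcongr
    have h3 : Real.exp (w₀ - 2) ≤ Real.exp (w₀ - 2 * ε) / 2 := by
      rw [show w₀ - 2 * ε = (w₀ - 2) + (2 - 2 * ε) by ring, Real.exp_add]
      have := Real.add_one_le_exp (2 - 2 * ε)
      nlinarith [Real.exp_pos (w₀ - 2)]
    have h4 : Z ω ≤ m / 2 := by
      calc Z ω ≤ G.card * (Real.exp (w₀ - 2 * ε) / 2) := h1.trans (by gcongr)
        _ = G.card * Real.exp (w₀ - 2 * ε) / 2 := by ring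
        _ ≤ _ := by gcongr
    rw [abs_sub_comm]
    exact (by linarith : m / 2 ≤ m - Z ω).trans (le_abs_self _)
  · rw [div_le_iff₀ (by positivity)]
    linarith

end

/-! ### Lower bound with the small primes fixed -/

theorem card_filter_lt_mul_le {ι : Type*} (s : Finset ι) (g : ι → ℝ) {t : ℝ} (ht : 0 ≤ t) :
    ((s.filter fun i => t < |g i|).card : ℝ) * t ^ 2 ≤ ∑ i ∈ s, g i ^ 2 := by
  rw [← nsmul_eq_mul, ← Finset.sum_const]
  calc ∑ _ ∈ s.filter fun i => t < |g i|, t ^ 2 ≤ ∑ i ∈ s.filter fun i => t < |g i|, g i ^ 2 := by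
        refine Finset.sum_le_sum fun i hi => ?_
        rw [← sq_abs (g i)]
        have := (Finset.mem_filter.1 hi).2
        gcongr
    _ ≤ _ := Finset.sum_le_sum_of_subset_of_nonneg (Finset.filter_subset _ _)
        fun _ _ _ => sq_nonneg _

/-- Chebyshev's inequality in `j`: the part free of large primes exceeds `2 √N` for at most a
quarter of the points, and the variance is off for at most a sixteenth. -/
theorem le_card_good {N M : ℕ} {κ β ε : ℝ} (hN : N ≠ 0) (hκ0 : 0 ≤ κ) (hκ1 : κ ≤ 1)
    (hβ : 0 < β) (hε0 : 0 < ε)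
    (hM : 4 * N < M) {S s : Finset ℕ} (hS : ∀ p ∈ S, p.Prime)
    (hSN : ∀ p ∈ S, ∀ q ∈ S, 2 * N < p * q) (hs : s ⊆ Finset.Icc 1 N)
    {a : ℕ → ℂ} (ha : ∀ n, ‖a n‖ ≤ 1)
    (h4 : 16 * β ^ 4 * N ^ 2 * ∑ p ∈ S, ((p : ℝ) ^ 4)⁻¹ ≤ ε ^ 2) :
    (M : ℝ) / 2 ≤ ((Finset.range M).filter fun j => ‖cycPoly M s a id j‖ ≤ 2 * √N ∧
      |∑ p ∈ S, quadForm κ (primePoly M N a p j) -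
        ∑ p ∈ S, (∑ m ∈ Finset.Icc 1 (N / p), ‖a m‖ ^ 2) / 2| ≤ ε / β ^ 2 * N).card := by
  have hN0 : (0 : ℝ) < N := by positivity
  have hsq : √(N : ℝ) ^ 2 = N := Real.sq_sqrt hN0.le
  set D := ∑ p ∈ S, (∑ m ∈ Finset.Icc 1 (N / p), ‖a m‖ ^ 2) / 2
  set g₁ : ℕ → ℝ := fun j => ‖cycPoly M s a id j‖ with hg₁
  set g₂ : ℕ → ℝ := fun j => ∑ p ∈ S, quadForm κ (primePoly M N a p j) - D with hg₂
  have c1 : (((Finset.range M).filter fun j => 2 * √N < |g₁ j|).card : ℝ) ≤ M / 4 := by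
    have h1 := card_filter_lt_mul_le (Finset.range M) g₁ (t := 2 * √N) (by positivity)
    have h2 : ∑ j ∈ Finset.range M, g₁ j ^ 2 ≤ M * N := by
      rw [hg₁, sum_norm_sq_cycPoly Function.injective_id.injOn
        (fun n hn => by have := (Finset.mem_Icc.1 (hs hn)).2; simp only [id]; omega)]
      gcongr
      calc ∑ n ∈ s, ‖a n‖ ^ 2 ≤ ∑ n ∈ s, (1 : ℝ) :=
            Finset.sum_le_sum fun m _ => pow_le_one₀ (norm_nonneg _) (ha m)
        _ = s.card := by simp
        _ ≤ N := by
          have := Finset.card_le_card hs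
          rw [Nat.card_Icc, Nat.add_sub_cancel] at this
          exact_mod_cast this
    rw [mul_pow, hsq] at h1
    have h3 := h1.trans h2
    rw [← mul_assoc, mul_le_mul_iff_left₀ hN0] at h3
    linarith
  have c2 : (((Finset.range M).filter fun j => ε / β ^ 2 * N < |g₂ j|).card : ℝ) ≤ M / 16 := by
    have h1 := card_filter_lt_mul_le (Finset.range M) g₂ (t := ε / β ^ 2 * N) (by positivity)
    have h2 := sum_sq_sum_quadForm_sub_le hκ0 hκ1 ha hM hS hSN
    have h3 := h1.trans h2
    have e : ∑ p ∈ S, ((N : ℝ) / p) ^ 4 = N ^ 4 * ∑ p ∈ S, ((p : ℝ) ^ 4)⁻¹ := by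
      rw [Finset.mul_sum]
      exact Finset.sum_congr rfl fun p _ => by rw [div_pow, div_eq_mul_inv]
    rw [e] at h3
    set c := (((Finset.range M).filter fun j => ε / β ^ 2 * N < |g₂ j|).card : ℝ)
    set s4 := ∑ p ∈ S, ((p : ℝ) ^ 4)⁻¹
    have h5 : c * (ε ^ 2 * N ^ 2) ≤ M / 16 * (ε ^ 2 * N ^ 2) := by
      calc c * (ε ^ 2 * N ^ 2) = (c * (ε / β ^ 2 * N) ^ 2) * β ^ 4 := by field_simp
        _ ≤ (M * (N ^ 4 * s4)) * β ^ 4 := by gcongr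
        _ = M / 16 * ((16 * β ^ 4 * N ^ 2 * s4) * N ^ 2) := by ring
        _ ≤ M / 16 * (ε ^ 2 * N ^ 2) := by gcongr
    exact le_of_mul_le_mul_right h5 (by positivity)
  have hcover : Finset.range M ⊆
      ((Finset.range M).filter fun j => ‖cycPoly M s a id j‖ ≤ 2 * √N ∧ |g₂ j| ≤ ε / β ^ 2 * N) ∪
      (((Finset.range M).filter fun j => 2 * √N < |g₁ j|) ∪
        ((Finset.range M).filter fun j => ε / β ^ 2 * N < |g₂ j|)) := by
    intro j hj
    have e1 : |g₁ j| = ‖cycPoly M s a id j‖ := abs_norm _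
    simp only [Finset.mem_union, Finset.mem_filter, hj, true_and, e1]
    by_cases h1 : ‖cycPoly M s a id j‖ ≤ 2 * √N
    · by_cases h2 : |g₂ j| ≤ ε / β ^ 2 * N
      · exact Or.inl ⟨h1, h2⟩
      · exact Or.inr (Or.inr (not_le.1 h2))
    · exact Or.inr (Or.inl (not_le.1 h1))
  have h := (Finset.card_le_card hcover).trans ((Finset.card_union_le _ _).trans
    (Nat.add_le_add_left (Finset.card_union_le _ _) _))
  rw [Finset.card_range] at h
  have h' : (M : ℝ) ≤ _ := Nat.cast_le (α := ℝ).2 h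
  push_cast at h'
  have : (0 : ℝ) ≤ M := by positivity
  linarith

/-- With the values at small primes fixed, a random multiplicative exponential sum is large
somewhere with high probability. -/
theorem measure_forall_norm_lt_le {Ω : Type*} [MeasurableSpace Ω] {P : Measure Ω}
    [IsProbabilityMeasure P] {N M : ℕ} {κ β ε : ℝ} (hN : N ≠ 0) (hκ0 : 0 ≤ κ) (hκ1 : κ ≤ 1)
    (hβ : 0 < β) (hε0 : 0 < ε) (hε : ε ≤ 1 / 10)
    (hM : 4 * N < M) {S s : Finset ℕ} (hS : ∀ p ∈ S, p.Prime)
    (hSN : ∀ p ∈ S, ∀ q ∈ S, 2 * N < p * q) (hs : s ⊆ Finset.Icc 1 N)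
    {a : ℕ → ℂ} (ha : ∀ n, ‖a n‖ ≤ 1) {ξ : S → Ω → ℂ} (hind : iIndepFun ξ P)
    (hξ : ∀ p, HasProjMoments κ (ξ p) P) {W : ℝ}
    (hW : W * N = ∑ p ∈ S, (∑ m ∈ Finset.Icc 1 (N / p), ‖a m‖ ^ 2) / 2)
    (h4 : 16 * β ^ 4 * N ^ 2 * ∑ p ∈ S, ((p : ℝ) ^ 4)⁻¹ ≤ ε ^ 2)
    (h2 : 4 * β ^ 4 * (∑ p ∈ S, ((p : ℝ) ^ 2)⁻¹) * Real.exp (β ^ 2 * W) ≤ ε ^ 3) :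
    P {ω | ∀ j ∈ Finset.range M,
      1 / √N * ‖cycPoly M s a id j + ∑ p : S, ξ p ω * primePoly M N a p j‖ <
        (β ^ 2 * W / 2 - 2) / β - 2} ≤ ENNReal.ofReal (36 * ε) := by
  have hN0 : (0 : ℝ) < N := by positivity
  have hM0 : (0 : ℝ) < M := by exact_mod_cast (by omega : 0 < M)
  have hsqN : (0 : ℝ) < √N := Real.sqrt_pos.2 hN0
  have hsq : √(N : ℝ) ^ 2 = N := Real.sq_sqrt hN0.le
  have hgood := le_card_good hN hκ0 hκ1 hβ hε0 hM hS hSN hs ha h4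
  set G := (Finset.range M).filter fun j => ‖cycPoly M s a id j‖ ≤ 2 * √N ∧
      |∑ p ∈ S, quadForm κ (primePoly M N a p j) -
        ∑ p ∈ S, (∑ m ∈ Finset.Icc 1 (N / p), ‖a m‖ ^ 2) / 2| ≤ ε / β ^ 2 * N with hG
  have hGne : G.Nonempty := by
    rw [← Finset.card_pos]
    exact_mod_cast (half_pos hM0).trans_le hgood
  set t : ℝ := β / √N with ht
  have ht0 : 0 < t := by positivity
  have ht2 : t ^ 2 = β ^ 2 / N := by rw [ht, div_pow, hsq]
  set z : ℕ → S → ℂ := fun j p => t * primePoly M N a p j with hz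
  have hznorm : ∀ j (p : S), ‖z j p‖ ≤ β * √N * (p : ℝ)⁻¹ := by
    intro j p
    rw [hz, norm_mul, Complex.norm_real, Real.norm_of_nonneg ht0.le]
    calc t * ‖primePoly M N a p j‖ ≤ t * (N / p) := by
          gcongr; exact norm_primePoly_le ha p j
      _ = β * √N * (p : ℝ)⁻¹ := by
          rw [ht]; nth_rw 2 [← hsq]; field_simp
  have hsum4 : ∑ p : S, (2 * (β * √N * ((p : ℕ) : ℝ)⁻¹)) ^ 4 ≤ ε ^ 2 := by
    rw [Finset.sum_coe_sort S (fun p => (2 * (β * √N * (p : ℝ)⁻¹)) ^ 4)]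
    refine le_trans (le_of_eq ?_) h4
    rw [Finset.mul_sum]
    refine Finset.sum_congr rfl fun p _ => ?_
    have : √(N : ℝ) ^ 4 = N ^ 2 := by
      rw [show √(N : ℝ) ^ 4 = (√(N : ℝ) ^ 2) ^ 2 by ring, hsq]
    rw [mul_pow, mul_pow, mul_pow, this, inv_pow]
    ring
  -- No separate bound on the tilt is needed: one term of the fourth power sum is at most `ε^2 ≤
  -- 1/100 < (1/2)^4`. The factor `2` leaves room for `z j p + z k p`.
  have hsmall : ∀ p : S, 2 * (β * √N * ((p : ℕ) : ℝ)⁻¹) ≤ 1 / 2 := by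
    intro p
    have h := Finset.single_le_sum (f := fun p : S => (2 * (β * √N * ((p : ℕ) : ℝ)⁻¹)) ^ 4)
      (fun _ _ => by positivity) (Finset.mem_univ p)
    refine le_of_pow_le_pow_left₀ (n := 4) (by norm_num) (by norm_num) ?_
    calc _ ≤ ε ^ 2 := h.trans hsum4
      _ ≤ (1 / 10) ^ 2 := by gcongr
      _ ≤ _ := by norm_num
  have hε2 : ε ^ 2 ≤ ε := by nlinarith
  set R : ℕ → Ω → ℝ := fun j ω => ∑ p : S, (z j p * ξ p ω).re with hR
  set w : ℕ → ℝ := fun j => (∑ p : S, quadForm κ (z j p)) / 2 with hw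
  have hwj : ∀ j, w j = β ^ 2 / N * (∑ p ∈ S, quadForm κ (primePoly M N a p j)) / 2 := by
    intro j
    simp only [hw, hz, quadForm_real_mul, ht2]
    rw [← Finset.mul_sum, Finset.sum_coe_sort S (fun p => quadForm κ (primePoly M N a p j))]
  set c : ℕ → ℕ → ℝ := fun j k => ∑ p : S, bilinForm κ (z j p) (z k p) with hc
  have hcjk : ∀ j k, c j k = β ^ 2 / N *
      ∑ p ∈ S, bilinForm κ (primePoly M N a p j) (primePoly M N a p k) := by
    intro j k
    rw [← ht2, Finset.mul_sum, hc]
    simp only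
    rw [← Finset.sum_coe_sort S]
    refine Finset.sum_congr rfl fun p _ => ?_
    simp only [hz, bilinForm_eq, Complex.re_ofReal_mul, Complex.im_ofReal_mul]
    ring
  -- The factor `4` in `ρ` comes from passing from `M^2` to the square of the number of good points,
  -- of which there are at least `M / 2`.
  have hmain := measure_forall_lt_le (P := P) hGne (R := R) (B := ∑ p : S, 1) (w := w) (c := c)
    (w₀ := β ^ 2 * W / 2) (ε := ε)
    (ρ := 4 * β ^ 4 * (∑ p ∈ S, ((p : ℝ) ^ 2)⁻¹) / ε ^ 2)
    (fun j _ => Finset.aemeasurable_fun_sum _ fun p _ =>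
      Complex.measurable_re.comp_aemeasurable ((hξ p).aemeasurable.const_mul _)) ?_ hε0.le hε
    ?_ ?_ ?_ ?_ ?_ ?_
  · refine (measure_mono fun ω hω => ?_).trans hmain
    simp only [Set.mem_ofPred_eq] at hω ⊢
    intro j hj
    have h1 := hω j (Finset.mem_filter.1 hj).1
    have h3 := (Finset.mem_filter.1 hj).2.1
    have e : R j ω = t * (∑ p : S, ξ p ω * primePoly M N a p j).re := by
      rw [Complex.re_sum, Finset.mul_sum]
      refine Finset.sum_congr rfl fun p _ => ?_
      rw [hz, ← Complex.re_ofReal_mul]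
      ring_nf
    set y := ∑ p : S, ξ p ω * primePoly M N a p j
    -- The fixed part has size at most `2 √N` at good points; this is the final `- 2` of the
    -- threshold.
    have h5 : y.re ≤ ‖cycPoly M s a id j + y‖ + 2 * √N := by
      have := (Complex.re_le_norm y).trans (norm_le_add_norm_add' (cycPoly M s a id j) y)
      linarith
    rw [e]
    have h6 : 1 / √N * y.re ≤ 1 / √N * ‖cycPoly M s a id j + y‖ + 2 := by
      calc 1 / √N * y.re ≤ 1 / √N * (‖cycPoly M s a id j + y‖ + 2 * √N) := by gcongr
        _ = _ := by field_simp
    have h7 : 1 / √N * y.re < (β ^ 2 * W / 2 - 2) / β := by linarith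
    rw [lt_div_iff₀ hβ] at h7
    calc t * y.re = 1 / √N * y.re * β := by rw [ht]; ring
      _ < _ := h7
  · intro j _
    have : ∀ᵐ ω ∂P, ∀ p : S, ‖ξ p ω‖ = 1 := ae_all_iff.2 fun p => (hξ p).norm_eq_one
    filter_upwards [this] with ω hω
    refine Finset.sum_le_sum fun p _ => (Complex.re_le_norm _).trans ?_
    rw [norm_mul, hω, mul_one]
    have := hznorm j p
    have h1 := hsmall p
    linarith [norm_nonneg (z j p)]
  · intro j _
    refine le_trans (Real.exp_le_exp.2 ?_) (le_integral_exp_sum hκ0 hκ1 hind hξ (z := z j) ?_)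
    · have : ∑ p : S, ‖z j p‖ ^ 4 ≤ ε := by
        refine le_trans (Finset.sum_le_sum fun p _ => ?_) (hsum4.trans hε2)
        have h1 := hznorm j p
        have h3 := norm_nonneg (z j p)
        gcongr
        linarith
      simp only [hw]
      linarith
    · intro p
      linarith [hznorm j p, hsmall p, norm_nonneg (z j p)]
  · intro j _ k _
    have e : ∀ ω, R j ω + R k ω = ∑ p : S, ((z j p + z k p) * ξ p ω).re := by
      intro ω
      simp only [hR, ← Finset.sum_add_distrib, add_mul, Complex.add_re]
    simp only [e]
    have hn : ∀ p, ‖z j p + z k p‖ ≤ 2 * (β * √N * ((p : ℕ) : ℝ)⁻¹) := fun p =>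
      (norm_add_le _ _).trans (by linarith [hznorm j p, hznorm k p])
    refine (integral_exp_sum_le hind hξ (z := fun p => z j p + z k p) ?_).trans
      (Real.exp_le_exp.2 ?_)
    · intro p
      linarith [hn p, hsmall p]
    · have : ∑ p : S, ‖z j p + z k p‖ ^ 4 ≤ ε := by
        refine le_trans (Finset.sum_le_sum fun p _ => ?_) (hsum4.trans hε2)
        have h1 := hn p
        gcongr
      have e2 : (∑ p : S, quadForm κ (z j p + z k p)) / 2 = w j + w k + c j k := by
        simp only [quadForm_add, Finset.sum_add_distrib, ← Finset.mul_sum, hw, hc]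
        ring
      rw [e2]
      linarith
  · intro j hj
    have h3 := (Finset.mem_filter.1 hj).2.2
    rw [← hW] at h3
    have e : w j - β ^ 2 * W / 2 =
        β ^ 2 / (2 * N) * (∑ p ∈ S, quadForm κ (primePoly M N a p j) - W * N) := by
      rw [hwj]; field_simp
    rw [e, abs_mul, abs_of_nonneg (by positivity)]
    calc _ ≤ β ^ 2 / (2 * N) * (ε / β ^ 2 * N) := by gcongr
      _ = ε / 2 := by field_simp
      _ ≤ ε := by linarith
  · intro j _ k _
    simp only [hw, hc]
    rw [← add_div, ← Finset.sum_add_distrib, Finset.sum_div]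
    refine Finset.sum_le_sum fun p _ => ?_
    linarith [two_mul_bilinForm_le hκ0 hκ1 (z j p) (z k p)]
  · have h1 := card_filter_lt_mul_le (Finset.range M ×ˢ Finset.range M)
      (fun x => ∑ p ∈ S, bilinForm κ (primePoly M N a p x.1) (primePoly M N a p x.2))
      (t := ε * N / β ^ 2) (by positivity)
    rw [Finset.sum_product_right] at h1
    have h3 := h1.trans (sum_sum_sq_sum_bilinForm_le hκ0 hκ1 ha hM hS hSN)
    have e : ∑ p ∈ S, ((N : ℝ) / p) ^ 2 = N ^ 2 * ∑ p ∈ S, ((p : ℝ) ^ 2)⁻¹ := by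
      rw [Finset.mul_sum]
      exact Finset.sum_congr rfl fun p _ => by rw [div_pow, div_eq_mul_inv]
    rw [e] at h3
    have hsub : (G ×ˢ G).filter (fun x => ε < c x.1 x.2) ⊆
        (Finset.range M ×ˢ Finset.range M).filter fun x => ε * N / β ^ 2 <
          |∑ p ∈ S, bilinForm κ (primePoly M N a p x.1) (primePoly M N a p x.2)| := by
      intro x hx
      obtain ⟨hx1, hx2⟩ := Finset.mem_filter.1 hx
      obtain ⟨hx3, hx4⟩ := Finset.mem_product.1 hx1
      refine Finset.mem_filter.2 ⟨Finset.mem_product.2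
        ⟨(Finset.mem_filter.1 hx3).1, (Finset.mem_filter.1 hx4).1⟩, ?_⟩
      rw [hcjk] at hx2
      refine lt_of_lt_of_le ?_ (le_abs_self _)
      rw [div_lt_iff₀ (by positivity)]
      rw [div_mul_eq_mul_div, lt_div_iff₀ hN0] at hx2
      linarith
    have hcard : (((G ×ˢ G).filter fun x => ε < c x.1 x.2).card : ℝ) ≤ _ :=
      Nat.cast_le.2 (Finset.card_le_card hsub)
    refine hcard.trans ?_
    set C := (((Finset.range M ×ˢ Finset.range M).filter fun x => ε * N / β ^ 2 <
          |∑ p ∈ S, bilinForm κ (primePoly M N a p x.1) (primePoly M N a p x.2)|).card : ℝ)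
    set s2 := ∑ p ∈ S, ((p : ℝ) ^ 2)⁻¹
    have hMG : (M : ℝ) ^ 2 ≤ 4 * (G.card : ℝ) ^ 2 := by nlinarith
    have hs2 : 0 ≤ s2 := Finset.sum_nonneg fun _ _ => by positivity
    have h5 : C * (N ^ 2 * ε ^ 2) ≤
        (4 * β ^ 4 * s2 / ε ^ 2 * (G.card : ℝ) ^ 2) * (N ^ 2 * ε ^ 2) := by
      calc C * (N ^ 2 * ε ^ 2) = C * (ε * N / β ^ 2) ^ 2 * β ^ 4 := by field_simp
        _ ≤ M ^ 2 * (N ^ 2 * s2) * β ^ 4 := by gcongr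
        _ ≤ (4 * (G.card : ℝ) ^ 2) * (N ^ 2 * s2) * β ^ 4 := by gcongr
        _ = _ := by field_simp
    exact le_of_mul_le_mul_right h5 (by positivity)
  · have e : 2 * (β ^ 2 * W / 2) = β ^ 2 * W := by ring
    rw [e, div_mul_eq_mul_div, div_le_iff₀ (by positivity)]
    calc _ ≤ ε ^ 3 := h2
      _ = _ := by ring

/-! ### Multiplicative extension and splitting by the large prime factor -/

/-- The multiplicative function with values `x p` at primes, weighted by `h`. -/
noncomputable def mulExt (h x : ℕ → ℂ) (n : ℕ) : ℂ :=
  h n * ∏ p ∈ n.primeFactors, x p ^ n.factorization p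

theorem mulExt_congr {h x y : ℕ → ℂ} {n : ℕ} (hxy : ∀ p ∈ n.primeFactors, x p = y p) :
    mulExt h x n = mulExt h y n := by
  rw [mulExt, mulExt, Finset.prod_congr rfl fun p hp => by rw [hxy p hp]]

theorem mulExt_mul_prime {h x : ℕ → ℂ} {m p : ℕ} (hp : p.Prime) (hm : m ≠ 0) (hpm : ¬ p ∣ m)
    (hh : h (m * p) = h m) : mulExt h x (m * p) = x p * mulExt h x m := by
  have hcop : m.Coprime p := ((Nat.Prime.coprime_iff_not_dvd hp).2 hpm).symm
  have h1 : ∏ q ∈ (m * p).primeFactors, x q ^ (m * p).factorization q =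
      (∏ q ∈ m.primeFactors, x q ^ (m * p).factorization q) *
        ∏ q ∈ p.primeFactors, x q ^ (m * p).factorization q := by
    rw [hcop.primeFactors_mul, Finset.prod_union hcop.disjoint_primeFactors]
  have hp1 : ∏ q ∈ p.primeFactors, x q ^ (m * p).factorization q = x p := by
    rw [hp.primeFactors, Finset.prod_singleton, Nat.factorization_mul hm hp.ne_zero,
      Finsupp.add_apply, Nat.factorization_eq_zero_of_not_dvd hpm, hp.factorization_self, zero_add,
      pow_one]
  have hm1 : ∏ q ∈ m.primeFactors, x q ^ (m * p).factorization q =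
      ∏ q ∈ m.primeFactors, x q ^ m.factorization q := by
    refine Finset.prod_congr rfl fun q hq => ?_
    have hqp : ¬ q ∣ p := fun hd => by
      rw [(Nat.prime_dvd_prime_iff_eq (Nat.prime_of_mem_primeFactors hq) hp).1 hd] at hq
      exact hpm (Nat.dvd_of_mem_primeFactors hq)
    rw [Nat.factorization_mul hm hp.ne_zero, Finsupp.add_apply,
      Nat.factorization_eq_zero_of_not_dvd hqp, add_zero]
  rw [mulExt, mulExt, hh, h1, hp1, hm1]
  ring

theorem norm_mulExt {h x : ℕ → ℂ} (hx : ∀ n, ‖x n‖ = 1) (n : ℕ) : ‖mulExt h x n‖ = ‖h n‖ := by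
  rw [mulExt, norm_mul, norm_prod]
  simp [hx]

theorem measurable_mulExt (h : ℕ → ℂ) (n : ℕ) : Measurable fun x : ℕ → ℂ => mulExt h x n := by
  unfold mulExt; fun_prop

/-- Splitting a sum over `n ≤ N` according to the large prime factor of `n`, if there is one. -/
theorem sum_Icc_eq_add_sum_primes {N : ℕ} {S : Finset ℕ} (hS : ∀ p ∈ S, p.Prime)
    (hSN : ∀ p ∈ S, ∀ q ∈ S, 2 * N < p * q) (g : ℕ → ℂ) :
    ∑ n ∈ Finset.Icc 1 N, g n = ∑ n ∈ (Finset.Icc 1 N).filter (fun n => ∀ p ∈ S, ¬ p ∣ n), g n +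
      ∑ p ∈ S, ∑ m ∈ Finset.Icc 1 (N / p), g (m * p) := by
  rw [← Finset.sum_filter_add_sum_filter_not (Finset.Icc 1 N) (fun n => ∀ p ∈ S, ¬ p ∣ n)]
  congr 1
  have e : (Finset.Icc 1 N).filter (fun n => ¬ ∀ p ∈ S, ¬ p ∣ n) =
      S.biUnion fun p => (Finset.Icc 1 (N / p)).image fun m => m * p := by
    ext n
    simp only [Finset.mem_filter, Finset.mem_biUnion, Finset.mem_image, Finset.mem_Icc]
    push Not
    constructor
    · rintro ⟨⟨hn1, hn2⟩, p, hp, m, rfl⟩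
      refine ⟨p, hp, m, ⟨?_, ?_⟩, mul_comm _ _⟩
      · exact Nat.pos_of_ne_zero (by rintro rfl; simp at hn1)
      · rwa [Nat.le_div_iff_mul_le (hS p hp).pos, mul_comm]
    · rintro ⟨p, hp, m, ⟨hm1, hm2⟩, rfl⟩
      rw [Nat.le_div_iff_mul_le (hS p hp).pos] at hm2
      exact ⟨⟨Nat.mul_pos hm1 (hS p hp).pos, hm2⟩, p, hp, dvd_mul_left _ _⟩
  rw [e, Finset.sum_biUnion]
  · refine Finset.sum_congr rfl fun p hp => ?_
    rw [Finset.sum_image (injOn_mul_right (hS p hp) _)]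
  · intro p hp q hq hpq
    rw [Function.onFun, Finset.disjoint_left]
    rintro _ h1 h2
    obtain ⟨m, hm, rfl⟩ := Finset.mem_image.1 h1
    obtain ⟨l, -, hl⟩ := Finset.mem_image.1 h2
    have hd : p * q ∣ m * p := ((Nat.coprime_primes (hS p hp) (hS q hq)).2 hpq).mul_dvd_of_dvd_of_dvd
      (dvd_mul_left _ _) ⟨l, by rw [mul_comm q]; exact hl.symm⟩
    have h3 := Nat.le_of_dvd (Nat.mul_pos (Finset.mem_Icc.1 hm).1 (hS p hp).pos) hd
    have h4 := mul_le_of_mem_Icc_div hm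
    have h5 := hSN p hp q hq
    omega

/-- The cofactor `m` of a large prime has no large prime factor itself, so changing the values on
`S` from `x` to `y` affects only the displayed factors `y p`. -/
theorem trigPoly_mulExt {N M : ℕ} {S : Finset ℕ} (hS : ∀ p ∈ S, p.Prime)
    (hSN : ∀ p ∈ S, ∀ q ∈ S, 2 * N < p * q) {h x y : ℕ → ℂ}
    (hh : ∀ m p, p.Prime → ¬ p ∣ m → h (m * p) = h m)
    (hxy : ∀ q ∉ S, x q = y q) (j : ℕ) :
    trigPoly (mulExt h y) N (j / M) = ((1 / √N : ℝ) : ℂ) *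
      (cycPoly M ((Finset.Icc 1 N).filter (fun n => ∀ p ∈ S, ¬ p ∣ n)) (mulExt h x) id j +
        ∑ p : S, y p * primePoly M N (mulExt h x) p j) := by
  rw [trigPoly, sum_Icc_eq_add_sum_primes hS hSN,
    Finset.sum_coe_sort S (fun p => y p * primePoly M N (mulExt h x) p j)]
  congr 2
  · refine Finset.sum_congr rfl fun n hn => ?_
    rw [mulExt_congr (y := x) fun q hq => (hxy q fun hqS =>
      (Finset.mem_filter.1 hn).2 q hqS (Nat.dvd_of_mem_primeFactors hq)).symm]
    simp [cycChar]
  · refine Finset.sum_congr rfl fun p hp => ?_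
    rw [primePoly, cycPoly, Finset.mul_sum]
    refine Finset.sum_congr rfl fun m hm => ?_
    have hm0 := (Finset.mem_Icc.1 hm).1
    have hmp := mul_le_of_mem_Icc_div hm
    have hnd : ∀ q ∈ S, ¬ q ∣ m := fun q hq hd => by
      have h1 := Nat.le_of_dvd hm0 hd
      have h2 := hSN q hq p hp
      have h3 := Nat.mul_le_mul_right p h1
      omega
    rw [mulExt_mul_prime (hS p hp) (by omega) (hnd p hp) (hh m p (hS p hp) (hnd p hp)),
      mulExt_congr (y := x) fun q hq => (hxy q fun hqS =>
        hnd q hqS (Nat.dvd_of_mem_primeFactors hq)).symm]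
    simp only [cycChar, Int.cast_natCast, mul_assoc]

theorem norm_trigPoly_le_maxTrigPoly (a : ℕ → ℂ) (N : ℕ) {θ : ℝ} (hθ : θ ∈ Set.Icc (0 : ℝ) 1) :
    ‖trigPoly a N θ‖ ≤ maxTrigPoly a N :=
  (isGreatest_maxTrigPoly a N).2 ⟨θ, hθ, rfl⟩

/-! ### Conditioning on the small primes -/

/-- Fubini for the product law: it suffices to bound the probability for almost every frozen value
of `X`. -/
theorem ProbabilityTheory.IndepFun.measure_prodMk_mem_le {Ω α β : Type*} [MeasurableSpace Ω]
    [MeasurableSpace α] [MeasurableSpace β] {P : Measure Ω} [IsProbabilityMeasure P] {X : Ω → α}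
    {Y : Ω → β} (h : IndepFun X Y P) (hX : AEMeasurable X P) (hY : AEMeasurable Y P)
    {E : Set (α × β)} (hE : MeasurableSet E) {δ : ENNReal}
    (hδ : ∀ᵐ ω ∂P, P {ω' | (X ω, Y ω') ∈ E} ≤ δ) : P {ω | (X ω, Y ω) ∈ E} ≤ δ := by
  have h1 := (indepFun_iff_map_prod_eq_prod_map_map hX hY).1 h
  have h2 : P {ω | (X ω, Y ω) ∈ E} = P.map (fun ω => (X ω, Y ω)) E :=
    (Measure.map_apply_of_aemeasurable (hX.prodMk hY) hE).symm
  have := Measure.isProbabilityMeasure_map (μ := P) hY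
  rw [h2, h1, Measure.prod_apply hE,
    lintegral_map' (measurable_measure_prodMk_left hE).aemeasurable hX]
  calc ∫⁻ ω, P.map Y (Prod.mk (X ω) ⁻¹' E) ∂P ≤ ∫⁻ _, δ ∂P := by
        refine lintegral_mono_ae ?_
        filter_upwards [hδ] with ω hω
        rwa [Measure.map_apply_of_aemeasurable hY (measurable_prodMk_left hE)]
    _ = δ := by simp

/-- The default value `1` keeps every coordinate of modulus one, so `norm_mulExt` applies to the
frozen values. -/
theorem indepFun_ite_primes {Ω : Type*} [MeasurableSpace Ω] {P : Measure Ω} {f : ℕ → Ω → ℂ}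
    (hind : iIndepFun (fun (p : Nat.Primes) => f p) P)
    (hf : ∀ p : Nat.Primes, AEMeasurable (f p) P) {S T : Finset ℕ} (hS : ∀ p ∈ S, p.Prime)
    (hT : ∀ p ∈ T, p.Prime) (hTS : Disjoint T S) :
    IndepFun (fun ω n => if n ∈ T then f n ω else 1) (fun ω n => if n ∈ S then f n ω else 1) P := by
  have hdisj : Disjoint (T.subtype Nat.Prime) (S.subtype Nat.Prime) := by
    rw [Finset.disjoint_left] at hTS ⊢
    intro p h1 h2
    exact hTS (Finset.mem_subtype.1 h1) (Finset.mem_subtype.1 h2)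
  have h := hind.indepFun_finset₀ (T.subtype Nat.Prime) (S.subtype Nat.Prime) hdisj hf
  have hext : ∀ U : Finset ℕ, (hU : ∀ p ∈ U, p.Prime) →
      ∃ φ : ((U.subtype Nat.Prime) → ℂ) → ℕ → ℂ, Measurable φ ∧
        ∀ ω, φ (fun p => f p ω) = fun n => if n ∈ U then f n ω else 1 := by
    intro U hU
    refine ⟨fun x n => if hn : n ∈ U then x ⟨⟨n, hU n hn⟩, Finset.mem_subtype.2 hn⟩ else 1, ?_, ?_⟩
    · refine measurable_pi_lambda _ fun n => ?_
      by_cases hn : n ∈ U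
      · simp only [hn, dite_true]; exact measurable_pi_apply _
      · simp only [hn, dite_false]; exact measurable_const
    · intro ω; funext n; by_cases hn : n ∈ U <;> simp [hn]
  obtain ⟨φ, hφ, eφ⟩ := hext T hT
  obtain ⟨ψ, hψ, eψ⟩ := hext S hS
  have := h.comp hφ hψ
  simpa only [Function.comp_def, eφ, eψ] using this

/-- The maximum of a random multiplicative exponential sum is large with high probability. -/
theorem measure_maxTrigPoly_lt_le {Ω : Type*} [MeasurableSpace Ω] {P : Measure Ω}
    [IsProbabilityMeasure P] {f : ℕ → Ω → ℂ} {κ : ℝ} (hκ0 : 0 ≤ κ) (hκ1 : κ ≤ 1)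
    (hind : iIndepFun (fun (p : Nat.Primes) => f p) P)
    (hf : ∀ p : Nat.Primes, HasProjMoments κ (f p) P) {h : ℕ → ℂ} (hh1 : ∀ n, ‖h n‖ ≤ 1)
    (hh : ∀ m p, p.Prime → ¬ p ∣ m → h (m * p) = h m)
    (hfh : ∀ n, 1 ≤ n → ∀ ω, f n ω = mulExt h (fun p => f p ω) n)
    {k N : ℕ} {β ε : ℝ} (hN : N ≠ 0) (hβ : 0 < β) (hε0 : 0 < ε) (hε : ε ≤ 1 / 10)
    (hkN : 2 * N < (k + 1) ^ 2) {W : ℝ}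
    (hW : W * N = ∑ p ∈ primesIoc k N, (∑ m ∈ Finset.Icc 1 (N / p), ‖h m‖ ^ 2) / 2)
    (h4 : 16 * β ^ 4 * N ^ 2 * ∑ p ∈ primesIoc k N, ((p : ℝ) ^ 4)⁻¹ ≤ ε ^ 2)
    (h2 : 4 * β ^ 4 * (∑ p ∈ primesIoc k N, ((p : ℝ) ^ 2)⁻¹) * Real.exp (β ^ 2 * W) ≤ ε ^ 3) :
    P {ω | maxTrigPoly (fun n => f n ω) N < (β ^ 2 * W / 2 - 2) / β - 2} ≤
      ENNReal.ofReal (36 * ε) := by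
  set t := (β ^ 2 * W / 2 - 2) / β - 2
  set S := primesIoc k N with hSdef
  -- The smallest modulus allowed by the degree `2 * N` of the variances.
  set M := 4 * N + 1 with hM
  have hS : ∀ p ∈ S, p.Prime := fun p hp => (mem_primesIoc.1 hp).2
  have hSN : ∀ p ∈ S, ∀ q ∈ S, 2 * N < p * q := fun p hp q hq => by
    have h1 := (mem_primesIoc.1 hp).1.1
    have h2 := (mem_primesIoc.1 hq).1.1
    have := Nat.mul_le_mul h1 h2
    rw [Nat.succ_eq_add_one] at this
    calc 2 * N < (k + 1) ^ 2 := hkN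
      _ = (k + 1) * (k + 1) := pow_two _
      _ ≤ _ := this
  set T := (primesIoc 0 N) \ S with hTdef
  have hT : ∀ p ∈ T, p.Prime := fun p hp => (mem_primesIoc.1 (Finset.mem_sdiff.1 hp).1).2
  set X : Ω → ℕ → ℂ := fun ω n => if n ∈ T then f n ω else 1 with hX
  set Y : Ω → ℕ → ℂ := fun ω n => if n ∈ S then f n ω else 1 with hY
  have hfm : ∀ p : Nat.Primes, AEMeasurable (f p) P := fun p => (hf p).aemeasurable
  have hXm : AEMeasurable X P := aemeasurable_pi_lambda _ fun n => by
    by_cases hn : n ∈ T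
    · simp only [hX, hn, if_true]; exact hfm ⟨n, hT n hn⟩
    · simp only [hX, hn, if_false]; exact aemeasurable_const
  have hYm : AEMeasurable Y P := aemeasurable_pi_lambda _ fun n => by
    by_cases hn : n ∈ S
    · simp only [hY, hn, if_true]; exact hfm ⟨n, hS n hn⟩
    · simp only [hY, hn, if_false]; exact aemeasurable_const
  have hXY : IndepFun X Y P := indepFun_ite_primes hind hfm hS hT Finset.sdiff_disjoint
  set s := (Finset.Icc 1 N).filter (fun n => ∀ p ∈ S, ¬ p ∣ n) with hs
  set E : Set ((ℕ → ℂ) × (ℕ → ℂ)) := {v | ∀ j ∈ Finset.range M,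
      1 / √N * ‖cycPoly M s (mulExt h v.1) id j +
        ∑ p : S, v.2 p * primePoly M N (mulExt h v.1) p j‖ < t} with hE
  have hEm : MeasurableSet E := by
    rw [hE]
    have hmul : ∀ n, Measurable fun v : (ℕ → ℂ) × (ℕ → ℂ) => mulExt h v.1 n := fun n =>
      (measurable_mulExt h n).comp measurable_fst
    have hy : ∀ n, Measurable fun v : (ℕ → ℂ) × (ℕ → ℂ) => v.2 n := fun n =>
      (measurable_pi_apply n).comp measurable_snd
    have hc : ∀ (s : Finset ℕ) (ν : ℕ → ℕ) (j : ℕ),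
        Measurable fun v : (ℕ → ℂ) × (ℕ → ℂ) => cycPoly M s (mulExt h v.1) ν j := fun s ν j =>
      Finset.measurable_fun_sum _ fun n _ => (hmul n).mul_const _
    rw [Set.ofPred_forall]
    refine MeasurableSet.iInter fun j => ?_
    rw [Set.ofPred_forall]
    refine MeasurableSet.iInter fun _ => measurableSet_lt (Measurable.const_mul
      (Measurable.norm ((hc _ _ _).add (Finset.measurable_fun_sum _ fun p _ =>
        (hy _).mul (hc _ _ _)))) _) measurable_const
  refine (measure_mono fun ω hω => ?_).trans
    (hXY.measure_prodMk_mem_le hXm hYm hEm (δ := ENNReal.ofReal (36 * ε)) ?_)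
  · intro j hj
    set y : ℕ → ℂ := fun n => if n ∈ S then f n ω else X ω n with hy
    have hfy : ∀ n ∈ Finset.Icc 1 N, f n ω = mulExt h y n := by
      intro n hn
      obtain ⟨hn1, hn2⟩ := Finset.mem_Icc.1 hn
      rw [hfh n hn1]
      refine mulExt_congr fun p hp => ?_
      have hpp := Nat.prime_of_mem_primeFactors hp
      have hpN := (Nat.le_of_dvd hn1 (Nat.dvd_of_mem_primeFactors hp)).trans hn2
      by_cases hpS : p ∈ S
      · simp [hy, hpS]
      · have : p ∈ T := Finset.mem_sdiff.2 ⟨mem_primesIoc.2 ⟨⟨hpp.pos, hpN⟩, hpp⟩, hpS⟩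
        simp [hy, hX, hpS, this]
    have e1 : trigPoly (fun n => f n ω) N (j / M) = trigPoly (mulExt h y) N (j / M) := by
      rw [trigPoly, trigPoly, Finset.sum_congr rfl fun n hn => by rw [hfy n hn]]
    have e2 := trigPoly_mulExt (M := M) hS hSN hh (x := X ω) (y := y)
      (fun q hq => by simp [hy, hq]) j
    have e3 : ∑ p : S, y p * primePoly M N (mulExt h (X ω)) p j =
        ∑ p : S, Y ω p * primePoly M N (mulExt h (X ω)) p j :=
      Finset.sum_congr rfl fun p _ => by simp [hy, hY]
    have hθ : (j / M : ℝ) ∈ Set.Icc (0 : ℝ) 1 := by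
      refine ⟨by positivity, div_le_one_of_le₀ ?_ (by positivity)⟩
      exact_mod_cast (Finset.mem_range.1 hj).le
    have h5 := norm_trigPoly_le_maxTrigPoly (fun n => f n ω) N hθ
    rw [e1, e2, e3, norm_mul, Complex.norm_real, Real.norm_of_nonneg (by positivity)] at h5
    exact h5.trans_lt hω
  · have hae : ∀ᵐ ω ∂P, ∀ n, ‖X ω n‖ = 1 := by
      refine ae_all_iff.2 fun n => ?_
      by_cases hn : n ∈ T
      · simp only [hX, hn, if_true]; exact (hf ⟨n, hT n hn⟩).norm_eq_one
      · simp [hX, hn]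
    filter_upwards [hae] with ω hω
    -- The moduli of the frozen coefficients are those of `h`, so the same `W` serves for almost
    -- every `ω`.
    have hnorm := norm_mulExt (h := h) hω
    have hcore := measure_forall_norm_lt_le (P := P) (M := M) (s := s)
      (ξ := fun (p : S) => f p) (a := mulExt h (X ω)) (W := W) hN hκ0 hκ1 hβ hε0 hε (by omega) hS
      hSN (Finset.filter_subset _ _) (fun n => (hnorm n).trans_le (hh1 n))
      (hind.precomp (g := fun p : S => (⟨p, hS p p.2⟩ : Nat.Primes))
        (fun p q hpq => Subtype.ext (congrArg (fun r : Nat.Primes => (r : ℕ)) hpq)))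
      (fun p => hf ⟨p, hS p p.2⟩) (by simp only [hnorm]; exact hW) h4 h2
    refine (measure_mono fun ω' hω' j hj => ?_).trans hcore
    have := hω' j hj
    simp only [hY, Finset.coe_mem, if_true] at this
    exact this

theorem IsSteinhausRMF.eq_mulExt {Ω : Type*} [MeasurableSpace Ω] {P : Measure Ω}
    {f : ℕ → Ω → ℂ} (hf : IsSteinhausRMF P f) (n : ℕ) (hn : 1 ≤ n) (ω : Ω) :
    f n ω = mulExt (fun _ => 1) (fun p => f p ω) n := by
  rw [hf.eq_prod n hn, mulExt, one_mul]

theorem IsRademacherRMF.eq_mulExt {Ω : Type*} [MeasurableSpace Ω] {P : Measure Ω}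
    {f : ℕ → Ω → ℂ} (hf : IsRademacherRMF P f) (n : ℕ) (hn : 1 ≤ n) (ω : Ω) :
    f n ω = mulExt (fun n => if Squarefree n then 1 else 0) (fun p => f p ω) n := by
  rw [hf.eq_prod n hn, mulExt]
  split_ifs with hsq
  · rw [one_mul]
    refine Finset.prod_congr rfl fun p hp => ?_
    have h1 := hsq.natFactorization_le_one p
    have h2 := (Nat.prime_of_mem_primeFactors hp).factorization_pos_of_dvd (by omega)
      (Nat.dvd_of_mem_primeFactors hp)
    rw [show n.factorization p = 1 by omega, pow_one, pow_one]
  · rw [zero_mul]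
    rw [Nat.squarefree_iff_factorization_le_one (by omega)] at hsq
    push Not at hsq
    obtain ⟨p, hp⟩ := hsq
    have hpn : p ∈ n.primeFactors := by
      rw [← Nat.support_factorization, Finsupp.mem_support_iff]; omega
    exact Finset.prod_eq_zero hpn (hf.prime_pow p (Nat.prime_of_mem_primeFactors hpn) _ hp ω)

/-! ### Choice of parameters and the limit -/

/-- The threshold `N ^ (7 / 10)` above which primes count as large. -/
noncomputable def largeThreshold (N : ℕ) : ℕ := ⌊Real.exp (7 / 10 * Real.log N)⌋₊

theorem tendsto_log_natCast : Tendsto (fun N : ℕ => Real.log N) atTop atTop :=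
  Real.tendsto_log_atTop.comp tendsto_natCast_atTop_atTop

theorem two_mul_lt_largeThreshold_sq {N : ℕ} (hN : N ≠ 0) (hL : 2 ≤ Real.log N) :
    2 * N < (largeThreshold N + 1) ^ 2 := by
  have hN0 : (0 : ℝ) < N := by positivity
  have h1 := Nat.lt_floor_add_one (Real.exp (7 / 10 * Real.log N))
  have h2 : (2 : ℝ) * N < ((largeThreshold N : ℝ) + 1) ^ 2 := by
    calc (2 : ℝ) * N = 2 * Real.exp (Real.log N) := by rw [Real.exp_log hN0]
      _ ≤ Real.exp (4 / 10 * Real.log N) * Real.exp (Real.log N) := by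
        gcongr
        linarith [Real.add_one_le_exp (4 / 10 * Real.log N), Real.quadratic_le_exp_of_nonneg
          (by linarith : 0 ≤ 4 / 10 * Real.log N), sq_nonneg (4 / 10 * Real.log N - 8 / 10)]
      _ = Real.exp (7 / 10 * Real.log N) ^ 2 := by
        rw [← Real.exp_add, pow_two, ← Real.exp_add]; ring_nf
      _ < _ := by
        rw [largeThreshold]
        gcongr
  exact_mod_cast h2

theorem eventually_le_sum_div_primesIoc {c : ℝ} (hc : c < 3 / 10) :
    ∀ᶠ N : ℕ in atTop,
      c * N ≤ ∑ p ∈ primesIoc (largeThreshold N) N, ((N / p : ℕ) : ℝ) := by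
  obtain ⟨C, hC⟩ := exists_le_sum_primesIoc_div
  filter_upwards [tendsto_log_natCast.eventually_ge_atTop 2,
    tendsto_log_natCast.eventually_ge_atTop (C / (3 / 10 - c)), eventually_ge_atTop 1]
    with N hL hLC hN
  have hN0 : (0 : ℝ) < N := by exact_mod_cast hN
  have hL0 : 0 < Real.log N := by linarith
  set k := largeThreshold N with hk
  have hkle : (k : ℝ) ≤ Real.exp (7 / 10 * Real.log N) := Nat.floor_le (Real.exp_pos _).le
  have hk1 : 1 ≤ k := Nat.le_floor (by
    rw [Nat.cast_one]; exact Real.one_le_exp (by positivity))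
  have hkN : k ≤ N := by
    have : (k : ℝ) ≤ N := hkle.trans (by
      nth_rw 2 [← Real.exp_log hN0]; exact Real.exp_le_exp.2 (by linarith))
    exact_mod_cast this
  have hlogk : Real.log k ≤ 7 / 10 * Real.log N := by
    have := Real.log_le_log (by exact_mod_cast hk1) hkle
    rwa [Real.log_exp] at this
  have hNk : N < (k + 1) ^ 2 :=
    lt_of_le_of_lt (Nat.le_mul_of_pos_left N two_pos)
      (two_mul_lt_largeThreshold_sq (Nat.one_le_iff_ne_zero.1 hN) hL)
  have h := hC k N hk1 hkN hNk
  refine le_of_mul_le_mul_right (le_trans ?_ h) hL0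
  rw [div_le_iff₀ (by linarith)] at hLC
  calc c * N * Real.log N = N * (c * Real.log N) := by ring
    _ ≤ _ := by gcongr; linarith

theorem one_le_largeThreshold {N : ℕ} : 1 ≤ largeThreshold N :=
  Nat.le_floor (by
    rw [Nat.cast_one]
    exact Real.one_le_exp (mul_nonneg (by norm_num) (Real.log_natCast_nonneg N)))

theorem inv_largeThreshold_le (N : ℕ) :
    (largeThreshold N : ℝ)⁻¹ ≤ 2 * Real.exp (-(7 / 10 * Real.log N)) := by
  have h1 : (1 : ℝ) ≤ largeThreshold N := by exact_mod_cast one_le_largeThreshold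
  have h2 := Nat.lt_floor_add_one (Real.exp (7 / 10 * Real.log N))
  rw [← largeThreshold] at h2
  rw [Real.exp_neg]
  calc (largeThreshold N : ℝ)⁻¹ ≤ (Real.exp (7 / 10 * Real.log N) / 2)⁻¹ :=
        inv_anti₀ (by positivity) (by linarith)
    _ = _ := by rw [inv_div, div_eq_mul_inv]

section numerics

variable {L g β W : ℝ}

theorem pow_four_le_of_sq_eq (hL : 0 < L) (hg : 0 < g) (hW : 6 * g ^ 2 ≤ W)
    (hβ : β ^ 2 = 2 * L / (3 * W)) :
    β ^ 2 ≤ L / (9 * g ^ 2) ∧ β ^ 4 ≤ L ^ 2 / (81 * g ^ 4) := by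
  have hW0 : 0 < W := lt_of_lt_of_le (by positivity) hW
  have h2 : β ^ 2 ≤ L / (9 * g ^ 2) := by
    rw [hβ, div_le_div_iff₀ (by positivity) (by positivity)]
    have := mul_le_mul_of_nonneg_left hW hL.le
    linarith
  refine ⟨h2, ?_⟩
  calc β ^ 4 = (β ^ 2) ^ 2 := by ring
    _ ≤ (L / (9 * g ^ 2)) ^ 2 := by gcongr
    _ = _ := by rw [div_pow]; ring

/-- The true exponent is `2 - 21/10 = -1/10`, so the threshold exponent must exceed `2/3`. The bound
is weakened to share its form with `covariance_error_le`. -/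
theorem fourth_moment_error_le (hL : 0 < L) (hg : 0 < g) (hβ : β ^ 4 ≤ L ^ 2 / (81 * g ^ 4))
    {s : ℝ} (hs0 : 0 ≤ s) (hs : s ≤ (2 * Real.exp (-(7 / 10 * L))) ^ 3) :
    16 * β ^ 4 * Real.exp L ^ 2 * s ≤ 2 / g ^ 4 * L ^ 2 * Real.exp (-(L / 30)) := by
  have e : Real.exp L ^ 2 * Real.exp (-(7 / 10 * L)) ^ 3 = Real.exp (-(L / 10)) := by
    rw [← Real.exp_nat_mul, ← Real.exp_nat_mul, ← Real.exp_add]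
    congr 1; push_cast; ring
  calc 16 * β ^ 4 * Real.exp L ^ 2 * s
      ≤ 16 * (L ^ 2 / (81 * g ^ 4)) * Real.exp L ^ 2 * (2 * Real.exp (-(7 / 10 * L))) ^ 3 := by
        gcongr
    _ = 128 / 81 / g ^ 4 * L ^ 2 * Real.exp (-(L / 10)) := by
        rw [← e]; field_simp; ring
    _ ≤ 2 / g ^ 4 * L ^ 2 * Real.exp (-(L / 30)) := by
        gcongr
        · norm_num
        · norm_num

/-- Here `-7/10 + 2/3 = -1/30`: the correlated pairs just lose against the tilt. -/
theorem covariance_error_le (hg : 0 < g) (hβ : β ^ 4 ≤ L ^ 2 / (81 * g ^ 4))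
    (hβW : β ^ 2 * W = 2 / 3 * L) {s : ℝ} (hs0 : 0 ≤ s) (hs : s ≤ 2 * Real.exp (-(7 / 10 * L))) :
    4 * β ^ 4 * s * Real.exp (β ^ 2 * W) ≤ 2 / g ^ 4 * L ^ 2 * Real.exp (-(L / 30)) := by
  have e : Real.exp (-(7 / 10 * L)) * Real.exp (2 / 3 * L) = Real.exp (-(L / 30)) := by
    rw [← Real.exp_add]; congr 1; ring
  calc 4 * β ^ 4 * s * Real.exp (β ^ 2 * W)
      ≤ 4 * (L ^ 2 / (81 * g ^ 4)) * (2 * Real.exp (-(7 / 10 * L))) * Real.exp (2 / 3 * L) := by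
        rw [hβW]
        gcongr
    _ = 8 / 81 / g ^ 4 * L ^ 2 * Real.exp (-(L / 30)) := by
        rw [← e]; field_simp; ring
    _ ≤ 2 / g ^ 4 * L ^ 2 * Real.exp (-(L / 30)) := by
        gcongr
        norm_num

/-- Since `β ≤ √L / (3 g)`, the main term `L / (3 β)` is at least `g √L`; the slack `6 g` absorbs
the `- 2`. The condition `6 ≤ √L` makes the left side nonnegative. -/
theorem mul_sqrt_sub_le_div (hL : 0 < L) (hg : 0 < g) (hβ : 0 < β)
    (hβ2 : β ^ 2 ≤ L / (9 * g ^ 2)) (h6 : 6 ≤ √L) :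
    g * √L - 6 * g ≤ (L / 3 - 2) / β := by
  have hs2 : √L ^ 2 = L := Real.sq_sqrt hL.le
  have hβs : β ≤ √L / (3 * g) := by
    refine le_of_pow_le_pow_left₀ two_ne_zero (by positivity) ?_
    rw [div_pow, hs2, mul_pow]
    norm_num
    exact hβ2
  rw [le_div_iff₀ hβ]
  have h0 : 0 ≤ g * √L - 6 * g := by
    have := mul_le_mul_of_nonneg_left h6 hg.le
    linarith
  calc (g * √L - 6 * g) * β ≤ (g * √L - 6 * g) * (√L / (3 * g)) := by gcongr
    _ = (√L ^ 2 - 6 * √L) / 3 := by field_simp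
    _ ≤ _ := by rw [hs2]; linarith

end numerics

section

variable {Ω : Type*} [MeasurableSpace Ω] {P : Measure Ω} [IsProbabilityMeasure P]
  {f : ℕ → Ω → ℂ} {κ : ℝ} {h : ℕ → ℂ} {g c : ℝ}

/-- The last hypothesis on `h` says `W ≥ 6 g^2`, which is what yields `√(W/6) ≥ g`. The gap between
`c` and `g` swallows the bounded losses. -/
theorem eventually_measure_maxTrigPoly_lt_le (hκ0 : 0 ≤ κ) (hκ1 : κ ≤ 1)
    (hind : iIndepFun (fun (p : Nat.Primes) => f p) P)
    (hf : ∀ p : Nat.Primes, HasProjMoments κ (f p) P) (hh1 : ∀ n, ‖h n‖ ≤ 1)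
    (hh : ∀ m p, p.Prime → ¬ p ∣ m → h (m * p) = h m)
    (hfh : ∀ n, 1 ≤ n → ∀ ω, f n ω = mulExt h (fun p => f p ω) n) (hg : 0 < g)
    (hcg : c < g)
    (hgh : ∀ᶠ N : ℕ in atTop, 6 * g ^ 2 * N ≤
      ∑ p ∈ primesIoc (largeThreshold N) N, (∑ m ∈ Finset.Icc 1 (N / p), ‖h m‖ ^ 2) / 2)
    {ε : ℝ} (hε0 : 0 < ε) (hε : ε ≤ 1 / 10) :
    ∀ᶠ N : ℕ in atTop, P {ω | maxTrigPoly (fun n => f n ω) N < c * √(Real.log N)} ≤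
      ENNReal.ofReal (36 * ε) := by
  have hdecay : Tendsto (fun N : ℕ => (Real.log N / 30) ^ 2 * Real.exp (-(Real.log N / 30)))
      atTop (𝓝 0) := (Real.tendsto_pow_mul_exp_neg_atTop_nhds_zero 2).comp
    (tendsto_log_natCast.atTop_div_const (by norm_num))
  have hsqrt : Tendsto (fun N : ℕ => √(Real.log N)) atTop atTop :=
    Real.tendsto_sqrt_atTop.comp tendsto_log_natCast
  filter_upwards [hgh, eventually_ge_atTop 1, tendsto_log_natCast.eventually_ge_atTop 2,
    hsqrt.eventually_ge_atTop ((2 + 6 * g) / (g - c)), hsqrt.eventually_ge_atTop 6,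
    -- `1800 = 2 * 30^2`: the factor `2` of the error bounds and the rescaling of `L` by `30`.
    hdecay.eventually_le_const (by positivity : 0 < ε ^ 3 * g ^ 4 / 1800)]
    with N hW hN hL hy hy6 hδ
  have hN0 : (0 : ℝ) < N := by exact_mod_cast hN
  have hNL : (N : ℝ) = Real.exp (Real.log N) := (Real.exp_log hN0).symm
  have hkinv := inv_largeThreshold_le N
  have hkne : largeThreshold N ≠ 0 := Nat.one_le_iff_ne_zero.1 one_le_largeThreshold
  have hkN := two_mul_lt_largeThreshold_sq (by omega : N ≠ 0) hL
  generalize largeThreshold N = k at *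
  set L := Real.log N
  have hL0 : 0 < L := by linarith
  obtain ⟨W, hWN⟩ : ∃ W : ℝ, W * N =
      ∑ p ∈ primesIoc k N, (∑ m ∈ Finset.Icc 1 (N / p), ‖h m‖ ^ 2) / 2 :=
    ⟨_, div_mul_cancel₀ _ hN0.ne'⟩
  have hW6 : 6 * g ^ 2 ≤ W := le_of_mul_le_mul_right (hWN ▸ hW) hN0
  have hW0 : 0 < W := lt_of_lt_of_le (by positivity) hW6
  -- This makes `β^2 W = 2 L / 3`, so the tilt costs `exp (β^2 W) = N^(2/3)`, just below `N^(7/10)`.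
  obtain ⟨β, hβ, hβ2⟩ : ∃ β : ℝ, 0 < β ∧ β ^ 2 = 2 * L / (3 * W) :=
    ⟨√(2 * L / (3 * W)), Real.sqrt_pos.2 (by positivity), Real.sq_sqrt (by positivity)⟩
  have hβW : β ^ 2 * W = 2 / 3 * L := by rw [hβ2]; field_simp
  obtain ⟨hβle, hβ4⟩ := pow_four_le_of_sq_eq hL0 hg hW6 hβ2
  have hδ' : 2 / g ^ 4 * L ^ 2 * Real.exp (-(L / 30)) ≤ ε ^ 3 := by
    rw [le_div_iff₀ (by norm_num)] at hδ
    rw [div_mul_eq_mul_div, div_mul_eq_mul_div, div_le_iff₀ (by positivity)]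
    linarith
  have hε32 : ε ^ 3 ≤ ε ^ 2 := pow_le_pow_of_le_one hε0.le (by linarith) (by norm_num)
  have h4 : 16 * β ^ 4 * N ^ 2 * ∑ p ∈ primesIoc k N, ((p : ℝ) ^ 4)⁻¹ ≤ ε ^ 2 := by
    refine le_trans ?_ (hδ'.trans hε32)
    have := fourth_moment_error_le hL0 hg hβ4
      (Finset.sum_nonneg fun _ _ => by positivity)
      ((sum_primesIoc_inv_pow_four_le (N := N) hkne).trans
      (by rw [← inv_pow]; gcongr))
    rwa [← hNL] at this
  have h2 : 4 * β ^ 4 * (∑ p ∈ primesIoc k N, ((p : ℝ) ^ 2)⁻¹) * Real.exp (β ^ 2 * W) ≤ ε ^ 3 :=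
    (covariance_error_le hg hβ4 hβW (Finset.sum_nonneg fun _ _ => by positivity)
      ((sum_primesIoc_inv_sq_le hkne).trans hkinv)).trans hδ'
  have hmain := measure_maxTrigPoly_lt_le hκ0 hκ1 hind hf hh1 hh hfh (by omega) hβ hε0 hε hkN hWN
    h4 h2
  refine (measure_mono fun ω hω => ?_).trans hmain
  rw [Set.mem_ofPred_eq] at hω ⊢
  refine hω.trans_le ?_
  have h5 := mul_sqrt_sub_le_div hL0 hg hβ hβle hy6
  rw [div_le_iff₀ (by linarith)] at hy
  have e : β ^ 2 * W / 2 - 2 = L / 3 - 2 := by rw [hβW]; ring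
  rw [e]
  linarith

theorem tendsto_measure_le_maxTrigPoly (hκ0 : 0 ≤ κ) (hκ1 : κ ≤ 1)
    (hind : iIndepFun (fun (p : Nat.Primes) => f p) P)
    (hf : ∀ p : Nat.Primes, HasProjMoments κ (f p) P) (hh1 : ∀ n, ‖h n‖ ≤ 1)
    (hh : ∀ m p, p.Prime → ¬ p ∣ m → h (m * p) = h m)
    (hfh : ∀ n, 1 ≤ n → ∀ ω, f n ω = mulExt h (fun p => f p ω) n) (hg : 0 < g)
    (hcg : c < g)
    (hgh : ∀ᶠ N : ℕ in atTop, 6 * g ^ 2 * N ≤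
      ∑ p ∈ primesIoc (largeThreshold N) N, (∑ m ∈ Finset.Icc 1 (N / p), ‖h m‖ ^ 2) / 2) :
    Tendsto (fun N : ℕ => P {ω | c * √(Real.log N) ≤ maxTrigPoly (fun n => f n ω) N})
      atTop (𝓝 1) := by
  have hbad0 : Tendsto (fun N : ℕ => P {ω | maxTrigPoly (fun n => f n ω) N < c * √(Real.log N)})
      atTop (𝓝 0) := by
    rw [ENNReal.tendsto_nhds_zero]
    intro δ hδ
    obtain ⟨r, hr0, hr⟩ := ENNReal.lt_iff_exists_real_btwn.1 hδ
    have hr1 : 0 < r := by simpa using hr.1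
    have h1 : 0 < min (r / 36) (1 / 10) := by positivity
    filter_upwards [eventually_measure_maxTrigPoly_lt_le hκ0 hκ1 hind hf hh1 hh hfh hg hcg hgh h1
      (min_le_right _ _)] with N hN
    refine hN.trans ((ENNReal.ofReal_le_ofReal ?_).trans hr.2.le)
    linarith [min_le_left (r / 36) (1 / 10)]
  have hsub := ENNReal.Tendsto.sub (tendsto_const_nhds (x := (1 : ENNReal)) (f := atTop)) hbad0
    (Or.inl ENNReal.one_ne_top)
  rw [tsub_zero] at hsub
  refine tendsto_of_tendsto_of_tendsto_of_le_of_le hsub tendsto_const_nhds (fun N => ?_)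
    fun N => prob_le_one
  rw [tsub_le_iff_right]
  calc (1 : ENNReal) = P Set.univ := measure_univ.symm
    _ ≤ P ({ω | c * √(Real.log N) ≤ maxTrigPoly (fun n => f n ω) N} ∪
        {ω | maxTrigPoly (fun n => f n ω) N < c * √(Real.log N)}) :=
      measure_mono fun ω _ => le_or_gt (c * √(Real.log N)) (maxTrigPoly (fun n => f n ω) N)
    _ ≤ _ := measure_union_le _ _

end

/-! ### The two models -/

theorem theorem1p1 {Ω : Type*} [MeasurableSpace Ω] (P : Measure Ω) [IsProbabilityMeasure P]
    (f : ℕ → Ω → ℂ) :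
    (IsRademacherRMF P f →
      Tendsto (fun N : ℕ => P {ω | 4 * Real.sqrt 6 / (29 * Real.pi) * Real.sqrt (Real.log N)
        ≤ maxTrigPoly (fun n => f n ω) N}) atTop (𝓝 1)) ∧
    (IsSteinhausRMF P f →
      Tendsto (fun N : ℕ => P {ω | 4 / 29 * Real.sqrt (Real.log N)
        ≤ maxTrigPoly (fun n => f n ω) N}) atTop (𝓝 1)) := by
  constructor
  · intro hf
    refine tendsto_measure_le_maxTrigPoly (κ := 1) zero_le_one le_rfl hf.indep
      (fun p => hasProjMoments_rademacher (hf.law_prime p))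
      (h := fun n => if Squarefree n then 1 else 0) (fun n => ?_) (fun m p hp hpm => ?_)
      -- With squarefree density at least `1/2`, `W ≥ 0.295 / 4 = 0.07375`, while `6 g^2 = 0.0726`;
      -- and `4 √6 / (29 π) < 0.11`.
      hf.eq_mulExt (g := 11 / 100) (by norm_num) ?_ ?_
    · split_ifs <;> simp
    · have hcop : m.Coprime p := ((Nat.Prime.coprime_iff_not_dvd hp).2 hpm).symm
      have : Squarefree (m * p) ↔ Squarefree m := Nat.squarefree_mul_iff.trans
        ⟨fun h => h.2.1, fun h => ⟨hcop, h, hp.squarefree⟩⟩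
      simp only [this]
    · have h6 : √6 < 2.45 := by
        rw [Real.sqrt_lt' (by norm_num)]; norm_num
      rw [div_lt_iff₀ (by positivity)]
      linarith [Real.pi_gt_d2]
    · filter_upwards [eventually_le_sum_div_primesIoc (c := 0.295) (by norm_num)] with N hN
      have : ∀ p ∈ primesIoc (largeThreshold N) N, ((N / p : ℕ) : ℝ) / 4 ≤
          (∑ m ∈ Finset.Icc 1 (N / p), ‖(if Squarefree m then 1 else 0 : ℂ)‖ ^ 2) / 2 := by
        intro p _
        have h1 := half_le_card_squarefree (N / p)
        have h2 : ∑ m ∈ Finset.Icc 1 (N / p), ‖(if Squarefree m then 1 else 0 : ℂ)‖ ^ 2 =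
            ((Finset.Icc 1 (N / p)).filter Squarefree).card := by
          rw [← Finset.sum_boole]
          exact Finset.sum_congr rfl fun m _ => by split_ifs <;> simp
        rw [h2]
        linarith
      have h3 := Finset.sum_le_sum this
      rw [← Finset.sum_div] at h3
      have : (0 : ℝ) ≤ N := Nat.cast_nonneg N
      linarith
  · intro hf
    refine tendsto_measure_le_maxTrigPoly (κ := 0) le_rfl zero_le_one hf.indep
      (fun p => hasProjMoments_steinhaus (hf.law_prime p)) (h := fun _ => 1) (by simp)
      -- Now `W ≥ 0.295 / 2 = 0.1475` against `6 g^2 = 0.14415`, and `4/29 < 0.155`.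
      (by simp) hf.eq_mulExt (g := 155 / 1000) (by norm_num) (by norm_num) ?_
    filter_upwards [eventually_le_sum_div_primesIoc (c := 0.295) (by norm_num)] with N hN
    have : (0 : ℝ) ≤ N := Nat.cast_nonneg N
    simp only [norm_one, one_pow, Finset.sum_const, Nat.card_Icc, Nat.add_sub_cancel, nsmul_eq_mul,
      mul_one]
    rw [← Finset.sum_div]
    linarith
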